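/- Let $\mathscr A$ be a non-empty set (the alphabet). For $F\subseteq\mathscr A^*$ let $\mathsf X=\mathsf X_F\subseteq\mathscr A^{\mathbb N}$ be the subshift of all sequences in which no word of $F$ occurs. Let $\mathcal L_{\mathsf X}$ be the set of all finite words occurring in elements of $\mathsf X$, including the empty word $\omega$, and assume that every letter $a\in\mathscr A$ belongs to $\mathcal L_{\mathsf X}$. For $\alpha,\beta\in\mathcal L_{\mathsf X}$ put $C(\alpha,\beta)=\{\beta x\in\mathsf X:\alpha x\in\mathsf X\}$, and let $\mathcal U$ be the Boolean algebra of subsets of $\mathsf X$ generated by all the sets $C(\alpha,\beta)$. Let $R$ be a field. The unital subshift algebra $\widetilde{\mathcal A}_R(\mathsf X)$ is the universal unital $R$-algebra with generators $\{p_A:A\in\mathcal U\}$ and $\{s_a,s_a^*:a\in\mathscr A\}$ subject to the relations (i) $p_{\mathsf X}=1$, $p_{A\cap B}=p_Ap_B$, $p_{A\cup B}=p_A+p_B-p_{A\cap B}$ and $p_\emptyset=0$ for all $A,B\in\mathcal U$; (ii) $s_as_a^*s_a=s_a$ and $s_a^*s_as_a^*=s_a^*$ for all $a\in\mathscr A$;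 (iii) $s_\beta s_\alpha^*s_\alpha s_\beta^*=p_{C(\alpha,\beta)}$ for all $\alpha,\beta\in\mathcal L_{\mathsf X}$, where $s_\omega=s_\omega^*=1$ and, for $\alpha=\alpha_1\cdots\alpha_n$, $s_\alpha=s_{\alpha_1}\cdots s_{\alpha_n}$ and $s_\alpha^*=s_{\alpha_n}^*\cdots s_{\alpha_1}^*$. Let $\mathcal Q_{\mathsf X}$ (the set of irrational paths) be the set of all singletons $\{p\}\in\mathcal U$ such that $p\neq\alpha\beta^\infty$ for all $\alpha,\beta\in\mathcal L_{\mathsf X}$ with $\beta\neq\omega$, where $\beta^\infty=\beta\beta\beta\cdots$. Let $\operatorname{Soc}(B)$ denote the (left) socle of a ring $B$, i.e. the sum of all minimal left ideals of $B$. **Theorem.** $$\operatorname{Soc}\bigl(\widetilde{\mathcal A}_R(\mathsf X)\bigr)=\sum_{A\in\mathcal Q_{\mathsf X}}\widetilde{\mathcal A}_R(\mathsf X)\,p_A .$$ -/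

import Mathlib

namespace UnitalSubshift

universe u v

section Symbolic

variable {𝒜 : Type u}

/-- The concatenation `w x` of a finite word `w` and an infinite sequence `x`. -/
def concat (w : List 𝒜) (x : ℕ → 𝒜) : ℕ → 𝒜 :=
  fun n => if h : n < w.length then w[n] else x (n - w.length)

/-- The infinite word `w w w …`, for a nonempty word `w`. -/
def infPow (w : List 𝒜) (hw : w ≠ []) : ℕ → 𝒜 :=
  fun n => w[n % w.length]'(Nat.mod_lt _ (List.length_pos_iff.mpr hw))

/-- The word of length `n` that occurs in the sequence `x` at position `i`. -/
def word (x : ℕ → 𝒜) (i n : ℕ) : List 𝒜 :=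
  List.ofFn (fun k : Fin n => x (i + k))

/-- The subshift `X_F`: the sequences in which no word of `F` occurs. -/
def avoiding (F : Set (List 𝒜)) : Set (ℕ → 𝒜) :=
  {x | ∀ i n : ℕ, word x i n ∉ F}

/-- A subshift over `𝒜` is a set of sequences of the form `X_F`. -/
def IsSubshift (X : Set (ℕ → 𝒜)) : Prop :=
  ∃ F : Set (List 𝒜), X = avoiding F

/-- The language of `X`: the finite initial words of the elements of `X`. -/
def language (X : Set (ℕ → 𝒜)) : Set (List 𝒜) :=
  {w | ∃ x ∈ X, ∃ n : ℕ, word x 0 n = w}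

/-- `C(α, β) = {β x ∈ X : α x ∈ X}`, as a subset of `X`. -/
def cylinder (X : Set (ℕ → 𝒜)) (α β : List 𝒜) : Set X :=
  {y | ∃ x : ℕ → 𝒜, (y : ℕ → 𝒜) = concat β x ∧ concat α x ∈ X}

/-- The Boolean algebra `𝒰` of subsets of `X` generated by the sets `C(α, β)` with
`α`, `β` in the language of `X`. -/
def boolAlg (X : Set (ℕ → 𝒜)) : BooleanSubalgebra (Set X) :=
  BooleanSubalgebra.closure {A | ∃ α ∈ language X, ∃ β ∈ language X, A = cylinder X α β}

/-- The irrational paths of `X`: the singletons `{p}` in `𝒰` such that `p` is not of the form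
`α β^∞` with `α`, `β` in the language of `X` (and `β` nonempty, so that `β^∞` makes sense). -/
def irrationalPaths (X : Set (ℕ → 𝒜)) : Set (boolAlg X) :=
  {A | ∃ p : X, (A : Set X) = {p} ∧
    ∀ α ∈ language X, ∀ β ∈ language X, ∀ hβ : β ≠ [],
      (p : ℕ → 𝒜) ≠ concat α (infPow β hβ)}

end Symbolic

section Algebra

/-- The generators of the unital subshift algebra: `p_A` for `A ∈ 𝒰`, and `s_a`, `s_a^*` for each
letter `a`. -/
inductive Gen {𝒜 : Type u} (X : Set (ℕ → 𝒜)) : Type u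
  | p (A : boolAlg X) : Gen X
  | s (a : 𝒜) : Gen X
  | sStar (a : 𝒜) : Gen X

variable (R : Type v) [CommRing R] {𝒜 : Type u} (X : Set (ℕ → 𝒜))

/-- The free generator `p_A`. -/
def freeP (A : boolAlg X) : FreeAlgebra R (Gen X) := FreeAlgebra.ι R (Gen.p A)

/-- The free generator `s_a`. -/
def freeS (a : 𝒜) : FreeAlgebra R (Gen X) := FreeAlgebra.ι R (Gen.s a)

/-- The free generator `s_a^*`. -/
def freeSStar (a : 𝒜) : FreeAlgebra R (Gen X) := FreeAlgebra.ι R (Gen.sStar a)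

/-- `s_α = s_{α₁} ⋯ s_{αₙ}`, which is `1` for the empty word. -/
def freeSWord (α : List 𝒜) : FreeAlgebra R (Gen X) := (α.map (freeS R X)).prod

/-- `s_α^* = s_{αₙ}^* ⋯ s_{α₁}^*`, which is `1` for the empty word. -/
def freeSStarWord (α : List 𝒜) : FreeAlgebra R (Gen X) := (α.reverse.map (freeSStar R X)).prod

/-- The defining relations of the unital subshift algebra. -/
inductive Rel : FreeAlgebra R (Gen X) → FreeAlgebra R (Gen X) → Prop
  | p_top : Rel (freeP R X ⊤) 1
  | p_inf (A B : boolAlg X) : Rel (freeP R X (A ⊓ B)) (freeP R X A * freeP R X B)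
  | p_sup (A B : boolAlg X) :
      Rel (freeP R X (A ⊔ B)) (freeP R X A + freeP R X B - freeP R X (A ⊓ B))
  | p_bot : Rel (freeP R X ⊥) 0
  | s_sStar_s (a : 𝒜) : Rel (freeS R X a * freeSStar R X a * freeS R X a) (freeS R X a)
  | sStar_s_sStar (a : 𝒜) :
      Rel (freeSStar R X a * freeS R X a * freeSStar R X a) (freeSStar R X a)
  | cyl (α β : List 𝒜) (hα : α ∈ language X) (hβ : β ∈ language X) :
      Rel (freeSWord R X β * freeSStarWord R X α * freeSWord R X α * freeSStarWord R X β)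
        (freeP R X ⟨cylinder X α β, BooleanSubalgebra.subset_closure ⟨α, hα, β, hβ, rfl⟩⟩)

/-- The unital subshift algebra of `X` over `R`: the universal unital `R`-algebra on the
generators `Gen X` subject to the relations `Rel R X`. -/
abbrev SubshiftAlgebra : Type (max u v) := RingQuot (Rel R X)

/-- The element `p_A` of the unital subshift algebra. -/
noncomputable def projection (A : boolAlg X) : SubshiftAlgebra R X :=
  RingQuot.mkAlgHom R (Rel R X) (freeP R X A)

end Algebra

/-- The (left) socle of a ring: the sum of all its minimal left ideals.
(`Ideal B` is the lattice of left ideals of `B`; its atoms are the minimal nonzero ones.) -/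
def leftSocle (B : Type v) [Ring B] : Ideal B :=
  sSup {I : Ideal B | IsAtom I}

end UnitalSubshift

/-! The algebra acts on the free `R[T;T⁻¹]`-module on the points of `X`: `p_A` restricts to `A`,
`s_a` sends `x` to `T • ax` (zero if `ax ∉ X`), and `s_a^*` sends `ax` to `T⁻¹ • x` and kills the
points not starting with `a`. The exponent of `T` records the degree `|α| - |β|` of a monomial `s_α
s_β^* p_D`; at an eventually periodic point, source and target alone do not determine it.

The monomials span (`span_monomials`), and two of them that are defined on all of `U` and take the
same value at one point of `U` agree after right multiplication by `p_U`
(`sWord_tWord_projection_eq`). Hence each `y` admits a finite cover of `X` by members of `𝒰` such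
that, if `y` kills one point of a member `U`, then `y p_U = 0` (`exists_local_cover`). In particular
the action is faithful.

Let `{p} ∈ 𝒰` with `p` aperiodic. A nonzero `x` in the left ideal of `p_{p}` moves `p` to a nonzero
vector. By aperiodicity each coefficient of this vector is a scalar times one power of `T`, so
cutting down to one point and moving back to `p` gives a nonzero scalar multiple of `p_{p}`. Thus
every nonzero subideal contains `p_{p}` (`mem_of_mul_projection_ne_zero`).

Conversely, a minimal left ideal contains some `y` with `y p = f • q`, `f ≠ 0`. If `q` were
eventually periodic, minimality would make some `T ^ n - 1`, `n > 0`, invertible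
(`aperiodic_of_isAtom`). Minimality also gives `p_W y = y` whenever `q ∈ W`, so all values of `y`
are multiples of `q`. Only finitely many points have a nonzero value of that kind, while by locality
`y` is nonzero throughout a neighbourhood of `p`; so `p` is isolated, and with it `q`. Then `y =
p_{q} y` lies in the irrational ideal, which is two-sided (`le_irrationalIdeal_of_isAtom`). -/

namespace UnitalSubshift

universe u v

/-! ### Words, shifts and aperiodic sequences. -/

section Words

variable {𝒜 : Type u}

/-- The sequence `x` with its first `i` letters deleted. -/
def shift (i : ℕ) (x : ℕ → 𝒜) : ℕ → 𝒜 := fun n => x (n + i)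

theorem shift_shift (i j : ℕ) (x : ℕ → 𝒜) : shift i (shift j x) = shift (i + j) x := by
  funext n; simp [shift, add_assoc]

@[simp] theorem shift_zero (x : ℕ → 𝒜) : shift 0 x = x := rfl

@[simp] theorem concat_nil (x : ℕ → 𝒜) : concat [] x = x := by
  funext n; simp [concat]

theorem concat_append (w v : List 𝒜) (x : ℕ → 𝒜) :
    concat (w ++ v) x = concat w (concat v x) := by
  funext n
  simp only [concat, List.length_append]
  by_cases h : n < w.length
  · simp [h, List.getElem_append_left, Nat.lt_add_right v.length h]
  · by_cases h' : n - w.length < v.length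
    · have h2 : n < w.length + v.length := by omega
      simp [h, h', h2, List.getElem_append_right (not_lt.mp h)]
    · have h2 : ¬ n < w.length + v.length := by omega
      simp [h, h', h2, Nat.sub_sub]

theorem concat_cons (a : 𝒜) (w : List 𝒜) (x : ℕ → 𝒜) :
    concat (a :: w) x = concat [a] (concat w x) := by
  rw [← concat_append]; rfl

@[simp] theorem shift_concat (w : List 𝒜) (x : ℕ → 𝒜) : shift w.length (concat w x) = x := by
  funext n; simp [shift, concat]

@[simp] theorem shift_one_concat (a : 𝒜) (x : ℕ → 𝒜) : shift 1 (concat [a] x) = x :=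
  shift_concat [a] x

theorem concat_right_injective (w : List 𝒜) : Function.Injective (concat w) := fun x y h => by
  rw [← shift_concat w x, h, shift_concat]

@[simp] theorem length_word (x : ℕ → 𝒜) (i n : ℕ) : (word x i n).length = n := by simp [word]

@[simp] theorem concat_word_shift (x : ℕ → 𝒜) (n : ℕ) : concat (word x 0 n) (shift n x) = x := by
  funext k
  by_cases h : k < n
  · simp [concat, word, h]
  · simp [concat, h, shift, Nat.sub_add_cancel (not_lt.mp h)]

@[simp] theorem word_concat (w : List 𝒜) (x : ℕ → 𝒜) : word (concat w x) 0 w.length = w := by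
  apply List.ext_getElem
  · simp
  · intro n h₁ h₂
    simp [word, concat]

theorem word_shift (x : ℕ → 𝒜) (i n k : ℕ) : word (shift k x) i n = word x (i + k) n := by
  simp only [word, shift]
  congr 1; funext m; congr 1; omega

@[simp] theorem concat_singleton_zero (a : 𝒜) (x : ℕ → 𝒜) : concat [a] x 0 = a := by
  simp [concat]

theorem concat_singleton_shift {a : 𝒜} {x : ℕ → 𝒜} (h : x 0 = a) :
    concat [a] (shift 1 x) = x := by
  subst h
  simpa [word] using concat_word_shift x 1

theorem exists_append_of_concat_eq {v w : List 𝒜} {x y : ℕ → 𝒜} (h : concat v x = concat w y)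
    (hl : w.length ≤ v.length) : ∃ u, v = w ++ u ∧ y = concat u x := by
  have hw : w = v.take w.length := by
    apply List.ext_getElem
    · simp [hl]
    · intro n h₁ h₂
      have := congrFun h n
      simp only [concat, h₁, h₁.trans_le hl, dif_pos] at this
      simp [this]
  refine ⟨v.drop w.length, ?_, ?_⟩
  · conv_lhs => rw [← List.take_append_drop w.length v, ← hw]
  · apply concat_right_injective w
    rw [← h, ← concat_append]
    congr 1
    conv_lhs => rw [← List.take_append_drop w.length v, ← hw]

theorem concat_infPow (w : List 𝒜) (hw : w ≠ []) :
    concat w (infPow w hw) = infPow w hw := by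
  funext n
  by_cases h : n < w.length
  · simp [concat, infPow, h, Nat.mod_eq_of_lt h]
  · simp only [concat, infPow, h, dif_neg, not_false_eq_true]
    congr 1
    conv_rhs => rw [← Nat.sub_add_cancel (not_lt.mp h), Nat.add_mod_right]

theorem eq_infPow_of_concat_eq (w : List 𝒜) (hw : w ≠ []) {x : ℕ → 𝒜} (h : concat w x = x) :
    x = infPow w hw := by
  have hpos : 0 < w.length := List.length_pos_iff.mpr hw
  funext n
  induction n using Nat.strong_induction_on with
  | _ n ih =>
    rw [← h, ← concat_infPow w hw]
    by_cases hn : n < w.length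
    · simp [concat, hn]
    · simp only [concat, hn, dif_neg, not_false_eq_true]
      exact ih _ (by omega)

/-- A sequence is aperiodic if its shifts are pairwise distinct. -/
def Aperiodic (x : ℕ → 𝒜) : Prop := Function.Injective fun i => shift i x

/-- A coincidence between two shifts of `q` persists after shifting by `j` more, where it becomes a
coincidence between shifts of `p`. -/
theorem Aperiodic.of_shift_eq {p q : ℕ → 𝒜} (hp : Aperiodic p) {i j : ℕ}
    (h : shift i p = shift j q) : Aperiodic q := by
  intro k l hkl
  have : shift (k + i) p = shift (l + i) p := by
    simp only [← shift_shift, h]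
    rw [shift_shift, shift_shift, add_comm k, add_comm l, ← shift_shift, ← shift_shift]
    exact congrArg _ hkl
  have := hp this
  omega

end Words

/-! ### Languages, cylinders and irrational paths. -/

section Subshift

variable {𝒜 : Type u} {X : Set (ℕ → 𝒜)}

theorem IsSubshift.shift_mem (hX : IsSubshift X) {x : ℕ → 𝒜} (hx : x ∈ X) (k : ℕ) :
    shift k x ∈ X := by
  obtain ⟨F, rfl⟩ := hX
  intro i n
  rw [word_shift]
  exact hx _ _

theorem IsSubshift.of_concat_mem (hX : IsSubshift X) {w : List 𝒜} {x : ℕ → 𝒜}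
    (h : concat w x ∈ X) : x ∈ X := by
  simpa using hX.shift_mem h w.length

theorem mem_language_iff {w : List 𝒜} : w ∈ language X ↔ ∃ x, concat w x ∈ X := by
  constructor
  · rintro ⟨x, hx, n, rfl⟩
    exact ⟨shift n x, by simpa using hx⟩
  · rintro ⟨x, hx⟩
    exact ⟨_, hx, w.length, by simp⟩

theorem word_mem_language {x : ℕ → 𝒜} (hx : x ∈ X) (n : ℕ) : word x 0 n ∈ language X :=
  ⟨x, hx, n, rfl⟩

theorem prefix_mem_language {v w : List 𝒜} (h : v ++ w ∈ language X) : v ∈ language X := by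
  obtain ⟨x, hx⟩ := mem_language_iff.mp h
  exact mem_language_iff.mpr ⟨_, by rwa [concat_append] at hx⟩

theorem IsSubshift.suffix_mem_language (hX : IsSubshift X) {v w : List 𝒜}
    (h : v ++ w ∈ language X) : w ∈ language X := by
  obtain ⟨x, hx⟩ := mem_language_iff.mp h
  rw [concat_append] at hx
  exact mem_language_iff.mpr ⟨_, hX.of_concat_mem hx⟩

theorem mem_cylinder {α β : List 𝒜} {y : X} :
    y ∈ cylinder X α β ↔ ∃ x, (y : ℕ → 𝒜) = concat β x ∧ concat α x ∈ X := Iff.rfl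

/-- The cylinder `C(α, β)` as an element of the Boolean algebra. -/
def cyl {α β : List 𝒜} (hα : α ∈ language X) (hβ : β ∈ language X) : boolAlg X :=
  ⟨cylinder X α β, BooleanSubalgebra.subset_closure ⟨α, hα, β, hβ, rfl⟩⟩

theorem mem_coe_cyl {α β : List 𝒜} (hα : α ∈ language X) (hβ : β ∈ language X) {y : X} :
    y ∈ (cyl hα hβ : Set X) ↔ ∃ x, (y : ℕ → 𝒜) = concat β x ∧ concat α x ∈ X := Iff.rfl

theorem mem_coe_inf {A B : boolAlg X} {x : X} :
    x ∈ ((A ⊓ B : boolAlg X) : Set X) ↔ x ∈ (A : Set X) ∧ x ∈ (B : Set X) := Iff.rfl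

theorem mem_coe_bot {x : X} : x ∈ ((⊥ : boolAlg X) : Set X) ↔ False := Iff.rfl

/-- The language condition defining irrational paths says that the sequence is aperiodic. -/
theorem aperiodic_iff (hX : IsSubshift X) {p : ℕ → 𝒜} (hp : p ∈ X) :
    Aperiodic p ↔ ∀ α ∈ language X, ∀ β ∈ language X, ∀ hβ : β ≠ [],
      p ≠ concat α (infPow β hβ) := by
  constructor
  · rintro h α - β - hβ rfl
    have h1 : shift α.length (concat α (infPow β hβ)) =
        shift (β.length + α.length) (concat α (infPow β hβ)) := by
      rw [← shift_shift, shift_concat]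
      conv_rhs => rw [← concat_infPow β hβ, shift_concat]
    have := h h1
    have := List.length_pos_iff.mpr hβ
    omega
  · intro h
    have key : ∀ i j, i < j → shift i p ≠ shift j p := by
      intro i j hij e
      -- The block of `p` between positions `i` and `j` is the period: prepending it to the tail
      -- from `j` gives the tail from `i`, which is the same sequence.
      have hw : word (shift i p) 0 (j - i) ≠ [] := by
        rw [← List.length_pos_iff]; simpa using hij
      refine h (word p 0 i) (word_mem_language hp i) _
        (word_mem_language (hX.shift_mem hp i) (j - i)) hw ?_
      have hs : shift (j - i) (shift i p) = shift i p := by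
        rw [shift_shift, Nat.sub_add_cancel hij.le, ← e]
      have h2 := concat_word_shift (shift i p) (j - i)
      rw [hs] at h2
      rw [← eq_infPow_of_concat_eq (x := shift i p) _ hw h2, concat_word_shift]
    intro i j e
    rcases lt_trichotomy i j with hij | hij | hij
    · exact (key i j hij e).elim
    · exact hij
    · exact (key j i hij e.symm).elim

theorem mem_irrationalPaths_iff (hX : IsSubshift X) {A : boolAlg X} :
    A ∈ irrationalPaths X ↔ ∃ p : X, (A : Set X) = {p} ∧ Aperiodic (p : ℕ → 𝒜) := by
  simp only [irrationalPaths, Set.mem_ofPred_eq]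
  exact exists_congr fun p => and_congr_right fun _ => (aperiodic_iff hX p.2).symm

end Subshift

/-! ### The defining relations and the Boolean calculus of projections. -/

section Relations

variable (R : Type v) [CommRing R] {𝒜 : Type u} (X : Set (ℕ → 𝒜))

/-- The generator `s_a` of the unital subshift algebra. -/
noncomputable def sLetter (a : 𝒜) : SubshiftAlgebra R X :=
  RingQuot.mkAlgHom R (Rel R X) (freeS R X a)

/-- The generator `s_a^*` of the unital subshift algebra. -/
noncomputable def tLetter (a : 𝒜) : SubshiftAlgebra R X :=
  RingQuot.mkAlgHom R (Rel R X) (freeSStar R X a)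

/-- The element `s_α` of the unital subshift algebra. -/
noncomputable def sWord (α : List 𝒜) : SubshiftAlgebra R X := (α.map (sLetter R X)).prod

/-- The element `s_α^*` of the unital subshift algebra. -/
noncomputable def tWord (α : List 𝒜) : SubshiftAlgebra R X := (α.reverse.map (tLetter R X)).prod

@[simp] theorem sWord_nil : sWord R X [] = 1 := rfl
@[simp] theorem tWord_nil : tWord R X [] = 1 := rfl

theorem sWord_cons (a : 𝒜) (α : List 𝒜) : sWord R X (a :: α) = sLetter R X a * sWord R X α := by
  simp [sWord]

theorem tWord_cons (a : 𝒜) (α : List 𝒜) : tWord R X (a :: α) = tWord R X α * tLetter R X a := by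
  simp [tWord]

theorem sWord_append (α β : List 𝒜) : sWord R X (α ++ β) = sWord R X α * sWord R X β := by
  simp [sWord]

theorem tWord_append (α β : List 𝒜) : tWord R X (α ++ β) = tWord R X β * tWord R X α := by
  simp [tWord]

theorem projection_top : projection R X ⊤ = 1 := by
  simpa [projection, sLetter, tLetter] using RingQuot.mkAlgHom_rel R (Rel.p_top (R := R) (X := X))

theorem projection_bot : projection R X ⊥ = 0 := by
  simpa [projection, sLetter, tLetter] using RingQuot.mkAlgHom_rel R (Rel.p_bot (R := R) (X := X))

theorem projection_inf (A B : boolAlg X) :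
    projection R X (A ⊓ B) = projection R X A * projection R X B := by
  simpa [projection, sLetter, tLetter] using RingQuot.mkAlgHom_rel R (Rel.p_inf (R := R) A B)

theorem projection_sup (A B : boolAlg X) : projection R X (A ⊔ B) =
    projection R X A + projection R X B - projection R X (A ⊓ B) := by
  simpa [projection, sLetter, tLetter] using RingQuot.mkAlgHom_rel R (Rel.p_sup (R := R) A B)

theorem sLetter_tLetter_sLetter (a : 𝒜) :
    sLetter R X a * tLetter R X a * sLetter R X a = sLetter R X a := by
  simpa [projection, sLetter, tLetter] using RingQuot.mkAlgHom_rel R (Rel.s_sStar_s (R := R) (X := X) a)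

theorem tLetter_sLetter_tLetter (a : 𝒜) :
    tLetter R X a * sLetter R X a * tLetter R X a = tLetter R X a := by
  simpa [projection, sLetter, tLetter] using RingQuot.mkAlgHom_rel R (Rel.sStar_s_sStar (R := R) (X := X) a)

theorem mkAlgHom_freeSWord (α : List 𝒜) :
    RingQuot.mkAlgHom R (Rel R X) (freeSWord R X α) = sWord R X α := by
  simp only [freeSWord, sWord, map_list_prod, List.map_map]
  rfl

theorem mkAlgHom_freeSStarWord (α : List 𝒜) :
    RingQuot.mkAlgHom R (Rel R X) (freeSStarWord R X α) = tWord R X α := by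
  simp only [freeSStarWord, tWord, map_list_prod, List.map_map]
  rfl

variable {X}

theorem projection_cyl {α β : List 𝒜} (hα : α ∈ language X) (hβ : β ∈ language X) :
    sWord R X β * tWord R X α * sWord R X α * tWord R X β = projection R X (cyl hα hβ) := by
  simpa only [map_mul, mkAlgHom_freeSWord, mkAlgHom_freeSStarWord, projection, cyl] using
    RingQuot.mkAlgHom_rel R (Rel.cyl (R := R) α β hα hβ)

theorem projection_mul_comm (A B : boolAlg X) :
    projection R X A * projection R X B = projection R X B * projection R X A := by
  rw [← projection_inf, ← projection_inf, inf_comm]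

theorem projection_mul_of_le {A B : boolAlg X} (h : A ≤ B) :
    projection R X A * projection R X B = projection R X A := by
  rw [← projection_inf, inf_eq_left.mpr h]

theorem projection_mul_of_ge {A B : boolAlg X} (h : B ≤ A) :
    projection R X A * projection R X B = projection R X B := by
  rw [← projection_inf, inf_eq_right.mpr h]

theorem projection_mul_of_disjoint {A B : boolAlg X} (h : Disjoint A B) :
    projection R X A * projection R X B = 0 := by
  rw [← projection_inf, h.eq_bot, projection_bot]

theorem projection_compl (A : boolAlg X) : projection R X Aᶜ = 1 - projection R X A := by
  have h := projection_sup R X A Aᶜ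
  rw [sup_compl_eq_top, inf_compl_eq_bot, projection_top, projection_bot] at h
  rw [h]; abel

theorem coe_injective {A B : boolAlg X} (h : (A : Set X) = B) : A = B := Subtype.ext h

theorem boolAlg_disjoint_of {A B : boolAlg X}
    (h : ∀ x, x ∈ (A : Set X) → x ∈ (B : Set X) → False) : Disjoint A B := by
  rw [disjoint_iff]
  apply coe_injective
  ext x
  simpa using h x

end Relations
end UnitalSubshift

namespace UnitalSubshift

universe u v

/-! ### Words as partial isometries, and their conjugation action on `𝒰`. -/

section Structure

variable (R : Type v) [CommRing R] {𝒜 : Type u} {X : Set (ℕ → 𝒜)}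

theorem nil_mem_language {α : List 𝒜} (h : α ∈ language X) : [] ∈ language X :=
  prefix_mem_language (v := []) h

theorem tWord_mul_sWord {α : List 𝒜} (hα : α ∈ language X) :
    tWord R X α * sWord R X α = projection R X (cyl hα (nil_mem_language hα)) := by
  simpa using projection_cyl R hα (nil_mem_language hα)

theorem sWord_mul_tWord {β : List 𝒜} (hβ : β ∈ language X) :
    sWord R X β * tWord R X β = projection R X (cyl (nil_mem_language hβ) hβ) := by
  simpa using projection_cyl R (nil_mem_language hβ) hβ

@[simp] theorem sWord_singleton (a : 𝒜) : sWord R X [a] = sLetter R X a := by simp [sWord]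
@[simp] theorem tWord_singleton (a : 𝒜) : tWord R X [a] = tLetter R X a := by simp [tWord]

theorem tLetter_mul_sLetter {a : 𝒜} (ha : [a] ∈ language X) :
    tLetter R X a * sLetter R X a = projection R X (cyl ha (nil_mem_language ha)) := by
  simpa using tWord_mul_sWord R ha

theorem sLetter_mul_tLetter {a : 𝒜} (ha : [a] ∈ language X) :
    sLetter R X a * tLetter R X a = projection R X (cyl (nil_mem_language ha) ha) := by
  simpa using sWord_mul_tWord R ha

/-- Words are partial isometries, and the words outside the language vanish. -/
theorem word_relations (hl : ∀ a : 𝒜, [a] ∈ language X) (α : List 𝒜) :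
    (sWord R X α * tWord R X α * sWord R X α = sWord R X α ∧
      tWord R X α * sWord R X α * tWord R X α = tWord R X α) ∧
    (α ∉ language X → sWord R X α = 0 ∧ tWord R X α = 0) := by
  induction α with
  | nil =>
    refine ⟨by simp, fun h => ?_⟩
    -- The empty word is missing from the language only if `X` is empty, and then the algebra is
    -- zero.
    have hXe : (⊤ : boolAlg X) = ⊥ := by
      apply coe_injective
      ext x
      exact (h ⟨x, x.2, 0, rfl⟩).elim
    have h0 : (1 : SubshiftAlgebra R X) = 0 := by
      rw [← projection_top, hXe, projection_bot]
    simpa using h0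
  | cons a β ih =>
    obtain ⟨⟨ih1, ih2⟩, ih3⟩ := ih
    rw [sWord_cons, tWord_cons]
    have sts := sLetter_tLetter_sLetter R X a
    have tst := tLetter_sLetter_tLetter R X a
    -- Both factors are projections when `β` is in the language; otherwise both sides vanish by
    -- induction. This is why the two claims are proved together.
    have hcomm : tLetter R X a * sLetter R X a * (sWord R X β * tWord R X β) =
        sWord R X β * tWord R X β * (tLetter R X a * sLetter R X a) := by
      by_cases hβ : β ∈ language X
      · rw [tLetter_mul_sLetter R (hl a), sWord_mul_tWord R hβ, projection_mul_comm]
      · simp [(ih3 hβ).1]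
    refine ⟨⟨?_, ?_⟩, fun h => ?_⟩
    · calc sLetter R X a * sWord R X β * (tWord R X β * tLetter R X a)
            * (sLetter R X a * sWord R X β)
          = sLetter R X a * (sWord R X β * tWord R X β * (tLetter R X a * sLetter R X a))
              * sWord R X β := by simp only [mul_assoc]
        _ = (sLetter R X a * tLetter R X a * sLetter R X a) *
              (sWord R X β * tWord R X β * sWord R X β) := by
            rw [← hcomm]; simp only [mul_assoc]
        _ = _ := by rw [sts, ih1]
    · calc tWord R X β * tLetter R X a * (sLetter R X a * sWord R X β)
            * (tWord R X β * tLetter R X a)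
          = tWord R X β * (tLetter R X a * sLetter R X a * (sWord R X β * tWord R X β))
              * tLetter R X a := by simp only [mul_assoc]
        _ = (tWord R X β * sWord R X β * tWord R X β) *
              (tLetter R X a * sLetter R X a * tLetter R X a) := by
            rw [hcomm]; simp only [mul_assoc]
        _ = _ := by rw [tst, ih2]
    · by_cases hβ : β ∈ language X
      · have h0 : tLetter R X a * sLetter R X a * (sWord R X β * tWord R X β) = 0 := by
          rw [tLetter_mul_sLetter R (hl a), sWord_mul_tWord R hβ]
          apply projection_mul_of_disjoint
          apply boolAlg_disjoint_of
          rintro x ⟨y, hy, hay⟩ ⟨z, hz, -⟩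
          rw [concat_nil] at hy
          rw [← hy, hz, ← concat_cons] at hay
          exact h (mem_language_iff.mpr ⟨_, hay⟩)
        constructor
        · rw [← ih1, ← sts]
          simp only [mul_assoc] at h0 ⊢
          rw [← mul_assoc (sWord R X β), ← mul_assoc (sLetter R X a) (sWord R X β * _)]
          simp only [mul_assoc]
          rw [show tLetter R X a * (sLetter R X a * (sWord R X β * (tWord R X β * sWord R X β)))
            = (tLetter R X a * (sLetter R X a * (sWord R X β * tWord R X β))) * sWord R X β by
              simp only [mul_assoc], h0, zero_mul, mul_zero]
        · rw [hcomm] at h0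
          rw [← ih2, ← tst]
          rw [show tWord R X β * sWord R X β * tWord R X β *
            (tLetter R X a * sLetter R X a * tLetter R X a) =
            tWord R X β * (sWord R X β * tWord R X β * (tLetter R X a * sLetter R X a))
              * tLetter R X a by simp only [mul_assoc], h0, mul_zero, zero_mul]
      · simp [ih3 hβ]

theorem sWord_tWord_sWord (hl : ∀ a : 𝒜, [a] ∈ language X) (α : List 𝒜) :
    sWord R X α * tWord R X α * sWord R X α = sWord R X α := (word_relations R hl α).1.1

theorem tWord_sWord_tWord (hl : ∀ a : 𝒜, [a] ∈ language X) (α : List 𝒜) :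
    tWord R X α * sWord R X α * tWord R X α = tWord R X α := (word_relations R hl α).1.2

theorem sWord_eq_zero (hl : ∀ a : 𝒜, [a] ∈ language X) {α : List 𝒜}
    (h : α ∉ language X) : sWord R X α = 0 := ((word_relations R hl α).2 h).1

theorem tWord_eq_zero (hl : ∀ a : 𝒜, [a] ∈ language X) {α : List 𝒜}
    (h : α ∉ language X) : tWord R X α = 0 := ((word_relations R hl α).2 h).2

theorem tLetter_mul_sLetter_of_ne {a b : 𝒜} (ha : [a] ∈ language X) (hb : [b] ∈ language X)
    (hab : a ≠ b) : tLetter R X a * sLetter R X b = 0 := by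
  have h0 : (sLetter R X a * tLetter R X a) * (sLetter R X b * tLetter R X b) = 0 := by
    rw [sLetter_mul_tLetter R ha, sLetter_mul_tLetter R hb]
    apply projection_mul_of_disjoint
    apply boolAlg_disjoint_of
    rintro x ⟨y, hy, -⟩ ⟨z, hz, -⟩
    apply hab
    rw [← concat_singleton_zero a y, ← hy, hz, concat_singleton_zero]
  rw [← tLetter_sLetter_tLetter R X a, ← sLetter_tLetter_sLetter R X b]
  rw [show tLetter R X a * sLetter R X a * tLetter R X a *
    (sLetter R X b * tLetter R X b * sLetter R X b) =
    tLetter R X a * (sLetter R X a * tLetter R X a * (sLetter R X b * tLetter R X b)) *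
      sLetter R X b by simp only [mul_assoc], h0, mul_zero, zero_mul]

/-- Conjugating the projections by a partial isometry which acts on the generating cylinders by
the Boolean map `θ` gives the projections of the sets `θ A`. -/
theorem exists_conj_projection (u w : SubshiftAlgebra R X) (θ : Set X → Set X)
    (huwu : u * w * u = u)
    (hcomm : ∀ A, w * u * projection R X A = projection R X A * (w * u))
    (hsup : ∀ A B, θ (A ∪ B) = θ A ∪ θ B) (hcompl : ∀ A, θ Aᶜ = θ Set.univ \ θ A)
    (htop : ∃ B : boolAlg X, (B : Set X) = θ Set.univ ∧ u * w = projection R X B)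
    (hgen : ∀ α (hα : α ∈ language X) β (hβ : β ∈ language X),
      ∃ B : boolAlg X, (B : Set X) = θ (cylinder X α β) ∧
        u * projection R X (cyl hα hβ) * w = projection R X B) (A : boolAlg X) :
    ∃ B : boolAlg X, (B : Set X) = θ A ∧ u * projection R X A * w = projection R X B := by
  obtain ⟨E, hE, huw⟩ := htop
  obtain ⟨A, hA⟩ := A
  -- Since `θ` need not preserve the whole space, complements are taken relative to `θ X`, whose
  -- projection is `u w`.
  have compl : ∀ A : boolAlg X,
      (∃ B : boolAlg X, (B : Set X) = θ A ∧ u * projection R X A * w = projection R X B) →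
      ∃ B : boolAlg X, (B : Set X) = θ (A : Set X)ᶜ ∧
        u * projection R X Aᶜ * w = projection R X B := by
    rintro A ⟨B, hB, h⟩
    refine ⟨E ⊓ Bᶜ, ?_, ?_⟩
    · rw [hcompl, ← hE, ← hB]; rfl
    · have hBE : B ≤ E := by
        change (B : Set X) ⊆ E
        rw [hB, hE, ← Set.union_univ (A : Set X), hsup]
        exact Set.subset_union_left
      rw [projection_inf, projection_compl, projection_compl, mul_sub, mul_one, sub_mul, huw, h,
        mul_sub, mul_one, projection_mul_of_ge R hBE]
  induction hA using BooleanSubalgebra.closure_bot_sup_induction with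
  | mem A hA =>
    obtain ⟨α, hα, β, hβ, rfl⟩ := hA
    exact hgen α hα β hβ
  | bot =>
    refine ⟨⊥, ?_, ?_⟩
    · have := hcompl Set.univ
      rw [Set.compl_univ, Set.sdiff_self] at this
      exact this.symm
    · rw [show (⟨⊥, BooleanSubalgebra.bot_mem⟩ : boolAlg X) = ⊥ from rfl, projection_bot]
      simp
  | sup A hA B hB ihA ihB =>
    obtain ⟨A', hA', h1⟩ := ihA
    obtain ⟨B', hB', h2⟩ := ihB
    refine ⟨A' ⊔ B', ?_, ?_⟩
    · change (A' : Set X) ∪ B' = θ (A ∪ B)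
      rw [hsup, hA', hB']
    · change u * projection R X (⟨A, hA⟩ ⊔ ⟨B, hB⟩) * w = _
      rw [ projection_sup, projection_sup, projection_inf, projection_inf, ← h1, ← h2]
      -- Conjugation is multiplicative: `w u` commutes with projections and is absorbed through `u w
      -- u = u`.
      have h3 : u * projection R X ⟨A, hA⟩ * w * (u * projection R X ⟨B, hB⟩ * w) =
          u * (projection R X ⟨A, hA⟩ * projection R X ⟨B, hB⟩) * w := by
        calc _ = u * (projection R X ⟨A, hA⟩ * (w * u)) * projection R X ⟨B, hB⟩ * w := by
              simp only [mul_assoc]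
          _ = (u * w * u) * projection R X ⟨A, hA⟩ * projection R X ⟨B, hB⟩ * w := by
              rw [← hcomm]; simp only [mul_assoc]
          _ = _ := by rw [huwu]; simp only [mul_assoc]
      rw [h3]
      simp only [mul_sub, mul_add, sub_mul, add_mul]
  | compl A hA ih => exact compl ⟨A, hA⟩ ih

/-- Conjugation by `s_a^*` realizes the preimage under `x ↦ ax`. By `exists_conj_projection`
cylinders suffice: `C(α, ω)` pulls back to `C(αa, ω)`, `C(α, aβ)` to `C(a, ω) ∩ C(α, β)`, and `C(α,
bβ)` with `b ≠ a` to the empty set; words outside the language also give the empty set. -/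
theorem exists_preimage_projection (hX : IsSubshift X) (hl : ∀ a : 𝒜, [a] ∈ language X) (a : 𝒜)
    (A : boolAlg X) : ∃ B : boolAlg X,
      (B : Set X) = {x : X | ∃ y ∈ (A : Set X), (y : ℕ → 𝒜) = concat [a] x} ∧
        tLetter R X a * projection R X A * sLetter R X a = projection R X B := by
  have hn := nil_mem_language (hl a)
  refine exists_conj_projection R _ _
    (fun A => {x : X | ∃ y ∈ A, (y : ℕ → 𝒜) = concat [a] x}) (tLetter_sLetter_tLetter R X a)
    (fun B => ?_) (fun A B => ?_) (fun A => ?_) ?_ ?_ A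
  · rw [sLetter_mul_tLetter R (hl a), projection_mul_comm]
  · ext x
    simp only [Set.mem_ofPred_eq, Set.mem_union, or_and_right, exists_or]
  · ext x
    simp only [Set.mem_ofPred_eq, Set.mem_sdiff, Set.mem_univ, true_and, Set.mem_compl_iff]
    constructor
    · rintro ⟨y, hy, e⟩
      refine ⟨⟨y, e⟩, ?_⟩
      rintro ⟨z, hz, e'⟩
      exact hy (by rwa [Subtype.ext (e.trans e'.symm)])
    · rintro ⟨⟨y, e⟩, h⟩
      exact ⟨y, fun hy => h ⟨y, hy, e⟩, e⟩
  · refine ⟨_, ?_, tLetter_mul_sLetter R (hl a)⟩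
    ext x
    simp only [mem_coe_cyl, concat_nil, Set.mem_ofPred_eq, Set.mem_univ, true_and,
      exists_eq_left', Subtype.exists, exists_prop]
    constructor
    · intro h; exact ⟨_, h, rfl⟩
    · rintro ⟨y, hy, rfl⟩; exact hy
  · intro α hα β hβ
    rw [← projection_cyl]
    cases β with
    | nil =>
      rw [sWord_nil, tWord_nil, one_mul, mul_one]
      have e : tLetter R X a * (tWord R X α * sWord R X α) * sLetter R X a =
          tWord R X (α ++ [a]) * sWord R X (α ++ [a]) := by
        simp only [tWord_append, sWord_append, tWord_singleton, sWord_singleton, mul_assoc]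
      rw [e]
      by_cases h : α ++ [a] ∈ language X
      · refine ⟨_, ?_, tWord_mul_sWord R h⟩
        ext x
        simp only [mem_coe_cyl, mem_cylinder, concat_nil, Set.mem_ofPred_eq, exists_eq_left',
          concat_append]
        constructor
        · intro h
          exact ⟨⟨_, hX.of_concat_mem h⟩, h, rfl⟩
        · rintro ⟨y, h, e⟩; rwa [e] at h
      · refine ⟨⊥, ?_, by rw [sWord_eq_zero R hl h, mul_zero, projection_bot]⟩
        ext x
        simp only [mem_coe_bot,
          mem_cylinder, concat_nil, Set.mem_ofPred_eq, exists_eq_left', false_iff]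
        rintro ⟨y, hy, e⟩
        rw [e, ← concat_append] at hy
        exact h (mem_language_iff.mpr ⟨_, hy⟩)
    | cons b β =>
      rw [sWord_cons, tWord_cons]
      by_cases hab : a = b
      · subst hab
        have hβ' : β ∈ language X := hX.suffix_mem_language (v := [a]) hβ
        refine ⟨cyl (hl a) hn ⊓ cyl hα hβ' ⊓ cyl (hl a) hn, ?_, ?_⟩
        · ext x
          simp only [mem_coe_inf, mem_coe_cyl, concat_nil, exists_eq_left', Set.mem_ofPred_eq]
          constructor
          · rintro ⟨⟨h1, z, hz, hz'⟩, -⟩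
            refine ⟨⟨_, h1⟩, ⟨z, ?_, hz'⟩, rfl⟩
            simp only [hz, concat_cons a β z]
          · rintro ⟨y, ⟨z, hz, hz'⟩, e⟩
            have h1 : concat [a] (x : ℕ → 𝒜) ∈ X := e ▸ y.2
            refine ⟨⟨h1, z, ?_, hz'⟩, h1⟩
            apply concat_right_injective [a]
            rw [← e, hz, concat_cons]
        · rw [projection_inf, projection_inf, ← projection_cyl R hα hβ', ← tLetter_mul_sLetter]
          simp only [mul_assoc]
      · refine ⟨⊥, ?_, ?_⟩
        · ext x
          simp only [mem_coe_bot,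
            mem_cylinder, Set.mem_ofPred_eq, false_iff]
          rintro ⟨y, ⟨z, hz, -⟩, e⟩
          apply hab
          rw [← concat_singleton_zero a x, ← e, hz, concat_cons, concat_singleton_zero]
        · rw [projection_bot]
          rw [← mul_assoc, ← mul_assoc, ← mul_assoc, ← mul_assoc, ← mul_assoc,
            tLetter_mul_sLetter_of_ne R (hl a) (hl b) hab]
          simp only [zero_mul]

/-- Prepending `a` takes `C(α, β)` to `C(α, aβ)`, or to the empty set when `aβ` is outside the
language. -/
theorem exists_image_projection (hX : IsSubshift X) (hl : ∀ a : 𝒜, [a] ∈ language X) (a : 𝒜)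
    (A : boolAlg X) : ∃ B : boolAlg X,
      (B : Set X) = {x : X | ∃ y ∈ (A : Set X), (x : ℕ → 𝒜) = concat [a] y} ∧
        sLetter R X a * projection R X A * tLetter R X a = projection R X B := by
  have hn := nil_mem_language (hl a)
  refine exists_conj_projection R _ _
    (fun A => {x : X | ∃ y ∈ A, (x : ℕ → 𝒜) = concat [a] y}) (sLetter_tLetter_sLetter R X a)
    (fun B => ?_) (fun A B => ?_) (fun A => ?_) ?_ ?_ A
  · rw [tLetter_mul_sLetter R (hl a), projection_mul_comm]
  · ext x
    simp only [Set.mem_ofPred_eq, Set.mem_union, or_and_right, exists_or]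
  · ext x
    simp only [Set.mem_ofPred_eq, Set.mem_sdiff, Set.mem_univ, true_and, Set.mem_compl_iff]
    constructor
    · rintro ⟨y, hy, e⟩
      refine ⟨⟨y, e⟩, ?_⟩
      rintro ⟨z, hz, e'⟩
      exact hy (by rwa [Subtype.ext (concat_right_injective _ (e.symm.trans e'))])
    · rintro ⟨⟨y, e⟩, h⟩
      exact ⟨y, fun hy => h ⟨y, hy, e⟩, e⟩
  · refine ⟨_, ?_, sLetter_mul_tLetter R (hl a)⟩
    ext x
    simp only [mem_coe_cyl, concat_nil, Set.mem_ofPred_eq, Set.mem_univ, true_and]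
    constructor
    · rintro ⟨y, e, hy⟩; exact ⟨⟨y, hy⟩, e⟩
    · rintro ⟨y, e⟩; exact ⟨y, e, y.2⟩
  · intro α hα β hβ
    rw [← projection_cyl]
    have e : sLetter R X a * (sWord R X β * tWord R X α * sWord R X α * tWord R X β) *
        tLetter R X a = sWord R X (a :: β) * tWord R X α * sWord R X α * tWord R X (a :: β) := by
      simp only [tWord_cons, sWord_cons, mul_assoc]
    rw [e]
    by_cases h : a :: β ∈ language X
    · refine ⟨_, ?_, projection_cyl R hα h⟩
      ext x
      simp only [mem_coe_cyl, mem_cylinder, Set.mem_ofPred_eq]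
      constructor
      · rintro ⟨z, hz, hz'⟩
        rw [concat_cons] at hz
        have hx := x.2
        rw [hz] at hx
        exact ⟨⟨_, hX.of_concat_mem hx⟩, ⟨z, rfl, hz'⟩, hz⟩
      · rintro ⟨y, ⟨z, hz, hz'⟩, e⟩
        exact ⟨z, by rw [e, hz, ← concat_cons], hz'⟩
    · refine ⟨⊥, ?_, by rw [sWord_eq_zero R hl h, projection_bot]; simp⟩
      ext x
      simp only [mem_coe_bot,
        mem_cylinder, Set.mem_ofPred_eq, false_iff]
      rintro ⟨y, ⟨z, hz, -⟩, e⟩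
      refine h (mem_language_iff.mpr ⟨z, ?_⟩)
      rw [concat_cons, ← hz, ← e]; exact x.2

/-- The commutation of projections past `s_a`. -/
theorem exists_projection_mul_sLetter (hX : IsSubshift X) (hl : ∀ a : 𝒜, [a] ∈ language X)
    (a : 𝒜) (A : boolAlg X) : ∃ B : boolAlg X,
      (B : Set X) = {x : X | ∃ y ∈ (A : Set X), (y : ℕ → 𝒜) = concat [a] x} ∧
        projection R X A * sLetter R X a = sLetter R X a * projection R X B := by
  obtain ⟨B, hB, h⟩ := exists_preimage_projection R hX hl a A
  refine ⟨B, hB, ?_⟩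
  rw [← h]
  conv_lhs => rw [← sLetter_tLetter_sLetter]
  simp only [← mul_assoc]
  rw [mul_assoc (projection R X A), sLetter_mul_tLetter R (hl a), projection_mul_comm]

/-- The commutation of projections past `s_a^*`. -/
theorem exists_projection_mul_tLetter (hX : IsSubshift X) (hl : ∀ a : 𝒜, [a] ∈ language X)
    (a : 𝒜) (A : boolAlg X) : ∃ B : boolAlg X,
      (B : Set X) = {x : X | ∃ y ∈ (A : Set X), (x : ℕ → 𝒜) = concat [a] y} ∧
        projection R X A * tLetter R X a = tLetter R X a * projection R X B := by
  obtain ⟨B, hB, h⟩ := exists_image_projection R hX hl a A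
  refine ⟨B, hB, ?_⟩
  rw [← h]
  conv_lhs => rw [← tLetter_sLetter_tLetter]
  simp only [← mul_assoc]
  rw [mul_assoc (projection R X A), tLetter_mul_sLetter R (hl a), projection_mul_comm]

/-- `𝒰` is closed under images and preimages of `x ↦ ax`, which is injective. Only the set-theoretic
halves of the conjugation lemmas are used, so the coefficient ring `ℤ` is an arbitrary choice. -/
theorem singleton_mem_boolAlg_iff_shift_one (hX : IsSubshift X)
    (hl : ∀ a : 𝒜, [a] ∈ language X) {x y : X} (h : (y : ℕ → 𝒜) = shift 1 x) :
    ({x} : Set X) ∈ boolAlg X ↔ ({y} : Set X) ∈ boolAlg X := by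
  have hx : (x : ℕ → 𝒜) = concat [(x : ℕ → 𝒜) 0] y := by rw [h, concat_singleton_shift rfl]
  constructor
  · intro hm
    obtain ⟨B, hB, -⟩ := exists_preimage_projection ℤ hX hl ((x : ℕ → 𝒜) 0) ⟨_, hm⟩
    convert B.2
    rw [hB]
    ext z
    simp only [Set.mem_singleton_iff, Set.mem_ofPred_eq, exists_eq_left]
    constructor
    · rintro rfl; exact hx
    · intro e; exact Subtype.ext (concat_right_injective _ (e.symm.trans hx))
  · intro hm
    obtain ⟨B, hB, -⟩ := exists_image_projection ℤ hX hl ((x : ℕ → 𝒜) 0) ⟨_, hm⟩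
    convert B.2
    rw [hB]
    ext z
    simp only [Set.mem_singleton_iff, Set.mem_ofPred_eq, exists_eq_left]
    rw [← hx, Subtype.ext_iff]

theorem singleton_mem_boolAlg_iff_shift (hX : IsSubshift X)
    (hl : ∀ a : 𝒜, [a] ∈ language X) (i : ℕ) {x y : X} (h : (y : ℕ → 𝒜) = shift i x) :
    ({x} : Set X) ∈ boolAlg X ↔ ({y} : Set X) ∈ boolAlg X := by
  induction i generalizing y with
  | zero => rw [show y = x from Subtype.ext h]
  | succ i ih =>
    rw [ih (y := ⟨_, hX.shift_mem x.2 i⟩) rfl]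
    apply singleton_mem_boolAlg_iff_shift_one hX hl
    rw [h, shift_shift, add_comm]

end Structure
end UnitalSubshift

namespace UnitalSubshift

universe u v

/-! ### The spanning monomials. -/

section Span

variable (R : Type v) [CommRing R] {𝒜 : Type u} {X : Set (ℕ → 𝒜)}

theorem subshiftAlgebra_induction {motive : SubshiftAlgebra R X → Prop}
    (scalar : ∀ r, motive (algebraMap R _ r)) (p : ∀ A, motive (projection R X A))
    (s : ∀ a, motive (sLetter R X a)) (t : ∀ a, motive (tLetter R X a))
    (mul : ∀ y z, motive y → motive z → motive (y * z))
    (add : ∀ y z, motive y → motive z → motive (y + z)) (y : SubshiftAlgebra R X) : motive y := by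
  obtain ⟨y, rfl⟩ := RingQuot.mkAlgHom_surjective R (Rel R X) y
  induction y using FreeAlgebra.induction with
  | grade0 r => simpa using scalar r
  | grade1 g =>
    cases g with
    | p A => exact p A
    | s a => exact s a
    | sStar a => exact t a
  | mul y z hy hz => rw [map_mul]; exact mul _ _ hy hz
  | add y z hy hz => rw [map_add]; exact add _ _ hy hz

variable (X) in
/-- The elements `s_α s_β^* p_D` with `D` contained in `C(α, β)`. -/
def monomials : Set (SubshiftAlgebra R X) :=
  {m | ∃ (α : List 𝒜) (hα : α ∈ language X) (β : List 𝒜) (hβ : β ∈ language X) (D : boolAlg X),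
    D ≤ cyl hα hβ ∧ m = sWord R X α * tWord R X β * projection R X D}

/-- The domain of `s_α s_β^*` is `C(α, β)`: in `s_β s_α^* s_α s_β^*` the commuting projections
`s_β^* s_β` and `s_α^* s_α` can be swapped and absorbed. This lets `D` be shrunk into `C(α, β)` in a
monomial. -/
theorem sWord_tWord_mul_projection_cyl (hl : ∀ a : 𝒜, [a] ∈ language X) {α β : List 𝒜}
    (hα : α ∈ language X) (hβ : β ∈ language X) :
    sWord R X α * tWord R X β * projection R X (cyl hα hβ) = sWord R X α * tWord R X β := by
  rw [← projection_cyl]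
  calc _ = sWord R X α * ((tWord R X β * sWord R X β) * (tWord R X α * sWord R X α))
        * tWord R X β := by simp only [mul_assoc]
    _ = (sWord R X α * tWord R X α * sWord R X α) *
        (tWord R X β * sWord R X β * tWord R X β) := by
      rw [tWord_mul_sWord R hα, tWord_mul_sWord R hβ, projection_mul_comm, ← tWord_mul_sWord R hα,
        ← tWord_mul_sWord R hβ]
      simp only [mul_assoc]
    _ = _ := by rw [sWord_tWord_sWord R hl, tWord_sWord_tWord R hl]

theorem monomial_mem_span (hl : ∀ a : 𝒜, [a] ∈ language X) (α β : List 𝒜) (D : boolAlg X) :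
    sWord R X α * tWord R X β * projection R X D ∈ Submodule.span R (monomials R X) := by
  by_cases hα : α ∈ language X
  · by_cases hβ : β ∈ language X
    · rw [← sWord_tWord_mul_projection_cyl R hl hα hβ, mul_assoc, ← projection_inf]
      exact Submodule.subset_span ⟨α, hα, β, hβ, _, inf_le_left, rfl⟩
    · rw [tWord_eq_zero R hl hβ, mul_zero, zero_mul]; exact zero_mem _
  · rw [sWord_eq_zero R hl hα, zero_mul, zero_mul]; exact zero_mem _

theorem mul_mem_span_monomials {g : SubshiftAlgebra R X}
    (hg : ∀ α β D, sWord R X α * tWord R X β * projection R X D * g ∈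
      Submodule.span R (monomials R X)) {z : SubshiftAlgebra R X}
    (hz : z ∈ Submodule.span R (monomials R X)) : z * g ∈ Submodule.span R (monomials R X) := by
  induction hz using Submodule.span_induction with
  | mem z hz =>
    obtain ⟨α, -, β, -, D, -, rfl⟩ := hz
    exact hg α β D
  | zero => rw [zero_mul]; exact zero_mem _
  | add x y _ _ hx hy => rw [add_mul]; exact add_mem hx hy
  | smul r x _ hx => rw [smul_mul_assoc]; exact Submodule.smul_mem _ _ hx

/-- The span contains `1` and is stable under right multiplication by each generator: `p_D` is first
moved past the letter, and then `s_b^* s_a` is a projection or zero. -/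
theorem span_monomials (hX : IsSubshift X) (hl : ∀ a : 𝒜, [a] ∈ language X) :
    Submodule.span R (monomials R X) = ⊤ := by
  suffices h : ∀ y z : SubshiftAlgebra R X, z ∈ Submodule.span R (monomials R X) →
      z * y ∈ Submodule.span R (monomials R X) by
    rw [eq_top_iff]
    rintro y -
    rw [← one_mul y]
    apply h
    simpa [projection_top] using monomial_mem_span R hl [] [] (⊤ : boolAlg X)
  intro y
  induction y using subshiftAlgebra_induction with
  | scalar r =>
    intro z hz
    rw [← Algebra.commutes, ← Algebra.smul_def]
    exact Submodule.smul_mem _ _ hz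
  | p A =>
    intro z hz
    refine mul_mem_span_monomials R (fun α β D => ?_) hz
    rw [mul_assoc, ← projection_inf]
    exact monomial_mem_span R hl _ _ _
  | s a =>
    intro z hz
    refine mul_mem_span_monomials R (fun α β D => ?_) hz
    obtain ⟨B, -, hB⟩ := exists_projection_mul_sLetter R hX hl a D
    rw [mul_assoc, hB, ← mul_assoc]
    cases β with
    | nil =>
      have := monomial_mem_span R hl (α ++ [a]) [] B
      simpa only [sWord_append, sWord_singleton, tWord_nil, mul_one] using this
    | cons b β =>
      rw [tWord_cons]
      by_cases hab : b = a
      · subst hab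
        have := monomial_mem_span R hl α β (cyl (hl b) (nil_mem_language (hl b)) ⊓ B)
        rw [projection_inf, ← tLetter_mul_sLetter] at this
        simpa only [mul_assoc] using this
      · have : sWord R X α * (tWord R X β * tLetter R X b) * sLetter R X a * projection R X B =
            sWord R X α * tWord R X β * (tLetter R X b * sLetter R X a) * projection R X B := by
          simp only [mul_assoc]
        rw [this, tLetter_mul_sLetter_of_ne R (hl b) (hl a) hab, mul_zero, zero_mul]
        exact zero_mem _
  | t a =>
    intro z hz
    refine mul_mem_span_monomials R (fun α β D => ?_) hz
    obtain ⟨B, -, hB⟩ := exists_projection_mul_tLetter R hX hl a D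
    have := monomial_mem_span R hl α (a :: β) B
    rw [tWord_cons] at this
    rw [mul_assoc, hB]
    simpa only [mul_assoc] using this
  | mul y z hy hz => intro w hw; rw [← mul_assoc]; exact hz _ (hy _ hw)
  | add y z hy hz => intro w hw; rw [mul_add]; exact add_mem (hy _ hw) (hz _ hw)

end Span

/-! ### The representation on the points of `X` over Laurent polynomials. -/

section Representation

open LaurentPolynomial
open scoped Classical

variable (R : Type v) [CommRing R] {𝒜 : Type u} {X : Set (ℕ → 𝒜)}

variable (X) in
/-- The free module on the points of `X` over the Laurent polynomials. -/
abbrev PointModule : Type (max u v) := X →₀ R[T;T⁻¹]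

variable (X) in
/-- The basis vector of a point of `X`, and zero for the other sequences. -/
noncomputable def pointVector (x : ℕ → 𝒜) : PointModule R X :=
  if h : x ∈ X then Finsupp.single ⟨x, h⟩ 1 else 0

theorem pointVector_coe (x : X) : pointVector R X x = Finsupp.single x 1 := by
  simp [pointVector]

theorem pointVector_of_notMem {x : ℕ → 𝒜} (h : x ∉ X) : pointVector R X x = 0 := by
  simp [pointVector, h]

theorem end_ext {f g : Module.End R[T;T⁻¹] (PointModule R X)}
    (h : ∀ x : X, f (pointVector R X x) = g (pointVector R X x)) : f = g := by
  apply Finsupp.lhom_ext'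
  intro x
  apply LinearMap.ext_ring
  simpa [pointVector_coe] using h x

/-- The action of `p_A`. -/
noncomputable def pEnd (A : Set X) : Module.End R[T;T⁻¹] (PointModule R X) :=
  Finsupp.linearCombination _ fun x => if x ∈ A then pointVector R X x else 0

variable (X) in
/-- The action of `s_a`. -/
noncomputable def sEnd (a : 𝒜) : Module.End R[T;T⁻¹] (PointModule R X) :=
  Finsupp.linearCombination _ fun x => (T 1 : R[T;T⁻¹]) • pointVector R X (concat [a] x)

variable (X) in
/-- The action of `s_a^*`. -/
noncomputable def tEnd (a : 𝒜) : Module.End R[T;T⁻¹] (PointModule R X) :=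
  Finsupp.linearCombination _ fun x =>
    if (x : ℕ → 𝒜) 0 = a then (T (-1) : R[T;T⁻¹]) • pointVector R X (shift 1 x) else 0

theorem pEnd_pointVector (A : Set X) (x : X) :
    pEnd R A (pointVector R X x) = if x ∈ A then pointVector R X x else 0 := by
  conv_lhs => rw [pointVector_coe]
  simp [pEnd]

theorem sEnd_pointVector (hX : IsSubshift X) (a : 𝒜) (x : ℕ → 𝒜) :
    sEnd R X a (pointVector R X x) = (T 1 : R[T;T⁻¹]) • pointVector R X (concat [a] x) := by
  by_cases h : x ∈ X
  · lift x to X using h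
    rw [pointVector_coe]
    simp [sEnd]
  · rw [pointVector_of_notMem R h, pointVector_of_notMem R fun h' => h (hX.of_concat_mem h')]
    simp

theorem tEnd_pointVector (a : 𝒜) (x : X) :
    tEnd R X a (pointVector R X x) =
      if (x : ℕ → 𝒜) 0 = a then (T (-1) : R[T;T⁻¹]) • pointVector R X (shift 1 x) else 0 := by
  conv_lhs => rw [pointVector_coe]
  simp [tEnd]

theorem sEnd_word (hX : IsSubshift X) (α : List 𝒜) (x : ℕ → 𝒜) :
    (α.map (sEnd R X)).prod (pointVector R X x) =
      (T α.length : R[T;T⁻¹]) • pointVector R X (concat α x) := by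
  induction α with
  | nil => simp
  | cons a α ih =>
    rw [List.map_cons, List.prod_cons, Module.End.mul_apply, ih, map_smul,
      sEnd_pointVector R hX, smul_smul, ← T_add, ← concat_cons]
    simp

theorem tEnd_word (hX : IsSubshift X) (β : List 𝒜) {x : ℕ → 𝒜} (h : concat β x ∈ X) :
    (β.reverse.map (tEnd R X)).prod (pointVector R X (concat β x)) =
      (T (-β.length) : R[T;T⁻¹]) • pointVector R X x := by
  induction β with
  | nil => simp
  | cons b β ih =>
    rw [concat_cons] at h
    rw [List.reverse_cons, List.map_append, List.prod_append, Module.End.mul_apply, concat_cons]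
    simp only [List.map_cons, List.map_nil, List.prod_singleton]
    rw [tEnd_pointVector R b ⟨_, h⟩]
    simp only [concat_singleton_zero, if_true, shift_one_concat]
    rw [map_smul, ih (hX.of_concat_mem h), smul_smul, ← T_add]
    congr 2
    simp

theorem tEnd_word_eq_zero (hX : IsSubshift X) (β : List 𝒜) (x : X)
    (h : ∀ y, (x : ℕ → 𝒜) ≠ concat β y) :
    (β.reverse.map (tEnd R X)).prod (pointVector R X x) = 0 := by
  induction β generalizing x with
  | nil => exact (h x (by simp)).elim
  | cons b β ih =>
    rw [List.reverse_cons, List.map_append, List.prod_append, Module.End.mul_apply]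
    simp only [List.map_cons, List.map_nil, List.prod_singleton]
    rw [tEnd_pointVector]
    split_ifs with hb
    · rw [map_smul, ih ⟨_, hX.shift_mem x.2 1⟩, smul_zero]
      intro y hy
      apply h y
      rw [concat_cons, ← hy, concat_singleton_shift hb]
    · rw [map_zero]

/-- The action of the generators. -/
noncomputable def genEnd : Gen X → Module.End R[T;T⁻¹] (PointModule R X)
  | .p A => pEnd R A
  | .s a => sEnd R X a
  | .sStar a => tEnd R X a

theorem pEnd_mul (A B : Set X) : pEnd R (A ∩ B) = pEnd R A * pEnd R B := by
  apply end_ext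
  intro x
  rw [Module.End.mul_apply, pEnd_pointVector, pEnd_pointVector]
  by_cases hA : x ∈ A <;> by_cases hB : x ∈ B <;> simp [hA, hB, pEnd_pointVector]

/-- The relations are homogeneous for `deg s_a = 1`, `deg s_a^* = -1`, `deg p_A = 0`, so the powers
of `T` match, and only the action on points remains to be compared. -/
theorem genEnd_rel (hX : IsSubshift X) {y z : FreeAlgebra R (Gen X)} (h : Rel R X y z) :
    FreeAlgebra.lift R (genEnd R) y = FreeAlgebra.lift R (genEnd R) z := by
  have hP : ∀ A, FreeAlgebra.lift R (genEnd R) (freeP R X A) = pEnd R (A : Set X) := fun A => by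
    simp [freeP, genEnd]
  have hS : ∀ a, FreeAlgebra.lift R (genEnd R) (freeS R X a) = sEnd R X a := fun a => by
    simp [freeS, genEnd]
  have hT : ∀ a, FreeAlgebra.lift R (genEnd R) (freeSStar R X a) = tEnd R X a := fun a => by
    simp [freeSStar, genEnd]
  induction h with
  | p_top =>
    rw [hP, map_one]
    exact end_ext R fun x => by rw [pEnd_pointVector]; exact if_pos trivial
  | p_inf A B =>
    rw [map_mul, hP, hP, hP]
    exact pEnd_mul R _ _
  | p_sup A B =>
    rw [map_sub, map_add, hP, hP, hP, hP]
    refine end_ext R fun x => ?_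
    rw [LinearMap.sub_apply, LinearMap.add_apply, pEnd_pointVector, pEnd_pointVector,
      pEnd_pointVector, pEnd_pointVector]
    by_cases hA : x ∈ (A : Set X) <;> by_cases hB : x ∈ (B : Set X) <;>
      simp [hA, hB]
  | p_bot =>
    rw [hP, map_zero]
    exact end_ext R fun x => by rw [pEnd_pointVector]; exact if_neg id
  | s_sStar_s a =>
    rw [map_mul, map_mul, hS, hT]
    refine end_ext R fun x => ?_
    rw [Module.End.mul_apply, Module.End.mul_apply, sEnd_pointVector R hX, map_smul]
    by_cases h : concat [a] (x : ℕ → 𝒜) ∈ X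
    · rw [tEnd_pointVector R a ⟨_, h⟩, if_pos (by simp), shift_one_concat, map_smul,
        map_smul, sEnd_pointVector R hX]
      simp only [smul_smul, ← T_add]
      simp
    · rw [pointVector_of_notMem R h]; simp
  | sStar_s_sStar a =>
    rw [map_mul, map_mul, hS, hT]
    refine end_ext R fun x => ?_
    rw [Module.End.mul_apply, Module.End.mul_apply, tEnd_pointVector]
    split_ifs with h
    · rw [map_smul, map_smul, sEnd_pointVector R hX, concat_singleton_shift h, map_smul,
        tEnd_pointVector, if_pos h, smul_smul (T 1), ← T_add]
      simp
    · simp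
  | cyl α β hα hβ =>
    have hSw : ∀ α, FreeAlgebra.lift R (genEnd R) (freeSWord R X α) = (α.map (sEnd R X)).prod :=
      fun α => by
        simp only [freeSWord, map_list_prod, List.map_map]
        congr 2; funext a; exact hS a
    have hTw : ∀ α, FreeAlgebra.lift R (genEnd R) (freeSStarWord R X α) =
        (α.reverse.map (tEnd R X)).prod := fun α => by
      simp only [freeSStarWord, map_list_prod, List.map_map]
      congr 2; funext a; exact hT a
    simp only [map_mul]
    rw [hSw, hSw, hTw, hTw, hP]
    refine end_ext R fun x => ?_
    simp only [Module.End.mul_apply]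
    rw [pEnd_pointVector]
    split_ifs with h
    · obtain ⟨y, hy, hαy⟩ := h
      have hβy : concat β y ∈ X := hy ▸ x.2
      rw [hy, tEnd_word R hX β hβy, map_smul, sEnd_word R hX, map_smul, map_smul, map_smul,
        map_smul, tEnd_word R hX α hαy, map_smul, sEnd_word R hX]
      simp only [smul_smul, ← T_add]
      rw [show -(β.length : ℤ) + (α.length + (-α.length + β.length)) = 0 by ring, T_zero, one_smul]
    · by_cases hx : ∃ y, (x : ℕ → 𝒜) = concat β y
      · obtain ⟨y, hy⟩ := hx
        have hβy : concat β y ∈ X := hy ▸ x.2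
        rw [hy, tEnd_word R hX β hβy, map_smul, sEnd_word R hX,
          pointVector_of_notMem R fun hαy => h ⟨y, hy, hαy⟩]
        simp
      · push Not at hx
        rw [tEnd_word_eq_zero R hX β x hx]
        simp

/-- The representation of the unital subshift algebra on the point module. -/
noncomputable def pointRep (hX : IsSubshift X) :
    SubshiftAlgebra R X →ₐ[R] Module.End R[T;T⁻¹] (PointModule R X) :=
  RingQuot.liftAlgHom R ⟨FreeAlgebra.lift R (genEnd R), fun _ _ h => genEnd_rel R hX h⟩

theorem pointRep_projection (hX : IsSubshift X) (A : boolAlg X) :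
    pointRep R hX (projection R X A) = pEnd R (A : Set X) := by
  simp [pointRep, projection, freeP, genEnd]

theorem pointRep_sWord (hX : IsSubshift X) (α : List 𝒜) :
    pointRep R hX (sWord R X α) = (α.map (sEnd R X)).prod := by
  simp only [sWord, map_list_prod, List.map_map]
  congr 2; funext a; simp [pointRep, sLetter, freeS, genEnd]

theorem pointRep_tWord (hX : IsSubshift X) (α : List 𝒜) :
    pointRep R hX (tWord R X α) = (α.reverse.map (tEnd R X)).prod := by
  simp only [tWord, map_list_prod, List.map_map]
  congr 2; funext a; simp [pointRep, tLetter, freeSStar, genEnd]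

theorem pointRep_projection_pointVector (hX : IsSubshift X) (A : boolAlg X) (x : X) :
    pointRep R hX (projection R X A) (pointVector R X x) =
      if x ∈ (A : Set X) then pointVector R X x else 0 := by
  rw [pointRep_projection, pEnd_pointVector]

theorem pointRep_sWord_tWord (hX : IsSubshift X) (α β : List 𝒜) {x : ℕ → 𝒜}
    (h : concat β x ∈ X) :
    pointRep R hX (sWord R X α * tWord R X β) (pointVector R X (concat β x)) =
      (T (α.length - β.length) : R[T;T⁻¹]) • pointVector R X (concat α x) := by
  rw [map_mul, Module.End.mul_apply, pointRep_sWord, pointRep_tWord, tEnd_word R hX β h,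
    map_smul, sEnd_word R hX, smul_smul, ← T_add]
  congr 2; ring

/-- The vectors `T ^ n • x`, for `x` a point of `X`, are independent over `R`. -/
theorem exists_linearMap_pointModule {N : Type*} [AddCommGroup N] [Module R N]
    (g : X → ℤ → N) : ∃ L : PointModule R X →ₗ[R] N,
      ∀ (x : X) n, L ((T n : R[T;T⁻¹]) • pointVector R X x) = g x n := by
  refine ⟨Finsupp.lsum R fun x => (Finsupp.linearCombination R (g x)).comp
    (AddMonoidAlgebra.coeffLinearEquiv R).toLinearMap, fun x n => ?_⟩
  have hT : AddMonoidAlgebra.coeffLinearEquiv R (T n : R[T;T⁻¹]) = Finsupp.single n 1 := rfl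
  rw [pointVector_coe, Finsupp.smul_single, smul_eq_mul, mul_one, Finsupp.lsum_single,
    LinearMap.comp_apply, LinearEquiv.coe_coe, hT, Finsupp.linearCombination_single, one_smul]

end Representation
end UnitalSubshift

namespace UnitalSubshift

universe u v

/-! ### Locality, faithfulness and coefficients of the representation. -/

section Local

open LaurentPolynomial
open scoped Classical

variable (R : Type v) [CommRing R] {𝒜 : Type u} {X : Set (ℕ → 𝒜)}

/-- The longer pair is `(α'γ, β'γ)` for one common word `γ`, and the extra factor `s_γ s_γ^*` acts
as the identity because `U` consists of points starting with `β'γ`. -/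
theorem sWord_tWord_projection_eq_of_le (hX : IsSubshift X) (hl : ∀ a : 𝒜, [a] ∈ language X)
    {α β α' β' : List 𝒜} (hα : α ∈ language X) (hβ : β ∈ language X) {U : boolAlg X}
    (hU : U ≤ cyl hα hβ) {z z' : ℕ → 𝒜} (h₁ : concat β z = concat β' z')
    (h₂ : concat α z = concat α' z')
    (hn : (α.length : ℤ) - β.length = α'.length - β'.length) (hle : β'.length ≤ β.length) :
    sWord R X α * tWord R X β * projection R X U =
      sWord R X α' * tWord R X β' * projection R X U := by
  obtain ⟨γ, rfl, rfl⟩ := exists_append_of_concat_eq h₁ hle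
  obtain ⟨γ', rfl, hγ⟩ := exists_append_of_concat_eq h₂ (by omega)
  -- Equal degrees give equal lengths, and both words are then the same prefix of `z'`. Without `hn`
  -- they could differ by periods of an eventually periodic tail.
  obtain rfl : γ = γ' := by
    have hlen : γ.length = γ'.length := by
      simp only [List.length_append, Nat.cast_add] at hn; omega
    rw [← word_concat γ z, hγ, hlen, word_concat]
  have hβ' : β' ∈ language X := prefix_mem_language hβ
  have hγL : γ ∈ language X := hX.suffix_mem_language hβ
  have hle' : U ≤ cyl (nil_mem_language hβ) hβ := by
    intro x hx
    obtain ⟨y, hy, -⟩ := hU hx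
    exact ⟨y, hy, by rw [concat_nil, ← concat_nil y]; exact
      hX.of_concat_mem (w := β' ++ γ) (by rw [concat_nil, ← hy]; exact x.2)⟩
  have key : sWord R X γ * tWord R X γ * tWord R X β' =
      tWord R X β' * projection R X (cyl (nil_mem_language hβ) hβ) := by
    rw [← sWord_mul_tWord, sWord_append, tWord_append]
    calc _ = (sWord R X γ * tWord R X γ) * (tWord R X β' * sWord R X β') * tWord R X β' := by
          conv_lhs => rw [← tWord_sWord_tWord R hl β']
          simp only [mul_assoc]
      _ = _ := by
          rw [sWord_mul_tWord R hγL, tWord_mul_sWord R hβ', projection_mul_comm,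
            ← sWord_mul_tWord R hγL, ← tWord_mul_sWord R hβ']
          simp only [mul_assoc]
  rw [sWord_append, tWord_append]
  calc _ = sWord R X α' * (sWord R X γ * tWord R X γ * tWord R X β') * projection R X U := by
        simp only [mul_assoc]
    _ = sWord R X α' * tWord R X β' *
        (projection R X (cyl (nil_mem_language hβ) hβ) * projection R X U) := by
        rw [key]; simp only [mul_assoc]
    _ = _ := by rw [projection_mul_of_ge R hle']

theorem sWord_tWord_projection_eq (hX : IsSubshift X) (hl : ∀ a : 𝒜, [a] ∈ language X)
    {α β α' β' : List 𝒜} (hα : α ∈ language X) (hβ : β ∈ language X) (hα' : α' ∈ language X)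
    (hβ' : β' ∈ language X) {U : boolAlg X} (hU : U ≤ cyl hα hβ) (hU' : U ≤ cyl hα' hβ')
    {z z' : ℕ → 𝒜} (h₁ : concat β z = concat β' z') (h₂ : concat α z = concat α' z')
    (hn : (α.length : ℤ) - β.length = α'.length - β'.length) :
    sWord R X α * tWord R X β * projection R X U =
      sWord R X α' * tWord R X β' * projection R X U := by
  rcases le_total β'.length β.length with h | h
  · exact sWord_tWord_projection_eq_of_le R hX hl hα hβ hU h₁ h₂ hn h
  · exact (sWord_tWord_projection_eq_of_le R hX hl hα' hβ' hU' h₁.symm h₂.symm hn.symm h).symm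

/-- A linear map which recovers `y p_U` from the value of `y` at the point `q` of `U`, for the
monomials `y` that are defined on all of `U`. -/
def IsGermMap (U : boolAlg X) (q : X) (L : PointModule R X →ₗ[R] SubshiftAlgebra R X) : Prop :=
  ∀ α (hα : α ∈ language X) β (hβ : β ∈ language X) z, U ≤ cyl hα hβ →
    (q : ℕ → 𝒜) = concat β z →
    L ((T (α.length - β.length) : R[T;T⁻¹]) • pointVector R X (concat α z)) =
      sWord R X α * tWord R X β * projection R X U

/-- The vectors `T ^ n • x` form an `R`-basis, so their images can be chosen freely. The choice is
consistent because all monomials defined on `U` with the same value at `q` agree on `U`; basis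
vectors that are no such value go to `0`. -/
theorem exists_isGermMap (hX : IsSubshift X) (hl : ∀ a : 𝒜, [a] ∈ language X) {U : boolAlg X}
    {q : X} (hq : q ∈ (U : Set X)) : ∃ L, IsGermMap R U q L := by
  let Good (x : X) (n : ℤ) (m : SubshiftAlgebra R X) : Prop :=
    ∃ (α : List 𝒜) (hα : α ∈ language X) (β : List 𝒜) (hβ : β ∈ language X) (z : ℕ → 𝒜),
      U ≤ cyl hα hβ ∧ (q : ℕ → 𝒜) = concat β z ∧ (x : ℕ → 𝒜) = concat α z ∧
        (α.length : ℤ) - β.length = n ∧ m = sWord R X α * tWord R X β * projection R X U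
  have huniq : ∀ x n m m', Good x n m → Good x n m' → m = m' := by
    rintro x n _ _ ⟨α, hα, β, hβ, z, hU, h1, h2, h3, rfl⟩ ⟨α', hα', β', hβ', z', hU', h1', h2', h3', rfl⟩
    exact sWord_tWord_projection_eq R hX hl hα hβ hα' hβ' hU hU' (h1.symm.trans h1')
      (h2.symm.trans h2') (h3.trans h3'.symm)
  obtain ⟨L, hL⟩ := exists_linearMap_pointModule R (X := X)
    fun x n => if h : ∃ m, Good x n m then h.choose else 0
  refine ⟨L, fun α hα β hβ z hU hz => ?_⟩
  have hαz : concat α z ∈ X := by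
    obtain ⟨y, hy, hy'⟩ := hU hq
    rw [hz] at hy
    rwa [concat_right_injective β hy]
  have hg : Good ⟨_, hαz⟩ _ _ := ⟨α, hα, β, hβ, z, hU, hz, rfl, rfl, rfl⟩
  have hex : ∃ m, Good ⟨_, hαz⟩ ((α.length : ℤ) - β.length) m := ⟨_, hg⟩
  rw [hL ⟨_, hαz⟩, dif_pos hex]
  exact huniq _ _ _ _ hex.choose_spec hg

theorem monomials_induction (hX : IsSubshift X) (hl : ∀ a : 𝒜, [a] ∈ language X)
    {motive : SubshiftAlgebra R X → Prop} (mem : ∀ m ∈ monomials R X, motive m) (zero : motive 0)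
    (add : ∀ y z, motive y → motive z → motive (y + z)) (smul : ∀ (r : R) y, motive y → motive (r • y))
    (y : SubshiftAlgebra R X) : motive y := by
  have hy : y ∈ Submodule.span R (monomials R X) := by
    rw [span_monomials R hX hl]; exact Submodule.mem_top
  induction hy using Submodule.span_induction with
  | mem m hm => exact mem m hm
  | zero => exact zero
  | add x y _ _ hx hy => exact add x y hx hy
  | smul r x _ hx => exact smul r x hx

/-- The value of a monomial at a point. -/
theorem pointRep_monomial (hX : IsSubshift X) {α β : List 𝒜} (D : boolAlg X) {x : X}
    {z : ℕ → 𝒜} (hx : x ∈ (D : Set X)) (hz : (x : ℕ → 𝒜) = concat β z) :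
    pointRep R hX (sWord R X α * tWord R X β * projection R X D) (pointVector R X x) =
      (T (α.length - β.length) : R[T;T⁻¹]) • pointVector R X (concat α z) := by
  rw [map_mul, Module.End.mul_apply, pointRep_projection_pointVector, if_pos hx, hz,
    pointRep_sWord_tWord R hX α β (hz ▸ x.2)]

theorem pointRep_monomial_of_notMem (hX : IsSubshift X) {α β : List 𝒜} (D : boolAlg X) {x : X}
    (hx : x ∉ (D : Set X)) :
    pointRep R hX (sWord R X α * tWord R X β * projection R X D) (pointVector R X x) = 0 := by
  rw [map_mul, Module.End.mul_apply, pointRep_projection_pointVector, if_neg hx, map_zero]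

/-- For a monomial with domain `D` it is enough that `U` lies inside `D` or misses it; both sides of
the formula are linear in `y`, so a general `y` needs only finitely many such `D`. -/
theorem exists_deciders (hX : IsSubshift X) (hl : ∀ a : 𝒜, [a] ∈ language X)
    (y : SubshiftAlgebra R X) : ∃ Ds : Set (boolAlg X), Ds.Finite ∧
      ∀ U : boolAlg X, (∀ D ∈ Ds, U ≤ D ∨ Disjoint U D) → ∀ q ∈ (U : Set X),
        ∀ L, IsGermMap R U q L →
          y * projection R X U = L (pointRep R hX y (pointVector R X q)) := by
  induction y using monomials_induction R hX hl with
  | mem m hm =>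
    obtain ⟨α, hα, β, hβ, D, hD, rfl⟩ := hm
    refine ⟨{D}, Set.finite_singleton D, fun U hU q hq L hL => ?_⟩
    rcases hU D rfl with h | h
    · obtain ⟨z, hz, hαz⟩ := hD (h hq)
      rw [pointRep_monomial R hX D (h hq) hz, hL α hα β hβ z (h.trans hD) hz, mul_assoc,
        projection_mul_of_ge R h]
    · have hqD : q ∉ (D : Set X) := fun hqD =>
        (disjoint_iff_inf_le.mp h : U ⊓ D ≤ ⊥) (show q ∈ ((U ⊓ D : boolAlg X) : Set X) from ⟨hq, hqD⟩)
      rw [pointRep_monomial_of_notMem R hX D hqD, map_zero, mul_assoc,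
        projection_mul_of_disjoint R h.symm, mul_zero]
  | zero => exact ⟨∅, Set.finite_empty, fun U _ q _ L _ => by simp⟩
  | add y z hy hz =>
    obtain ⟨D₁, hf₁, h₁⟩ := hy
    obtain ⟨D₂, hf₂, h₂⟩ := hz
    refine ⟨D₁ ∪ D₂, hf₁.union hf₂, fun U hU q hq L hL => ?_⟩
    rw [add_mul, h₁ U (fun D hD => hU D (.inl hD)) q hq L hL,
      h₂ U (fun D hD => hU D (.inr hD)) q hq L hL, map_add, LinearMap.add_apply, map_add]
  | smul r y hy =>
    obtain ⟨D₁, hf₁, h₁⟩ := hy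
    refine ⟨D₁, hf₁, fun U hU q hq L hL => ?_⟩
    rw [smul_mul_assoc, h₁ U hU q hq L hL, map_smul, LinearMap.smul_apply, map_smul]

/-- Each `D` cuts every member of the cover into its parts inside and outside `D`; some parts may be
empty. -/
theorem exists_deciding_cover {B : Type*} [BooleanAlgebra B] {Ds : Set B} (h : Ds.Finite) :
    ∃ P : Finset B, P.sup id = ⊤ ∧ ∀ U ∈ P, ∀ D ∈ Ds, U ≤ D ∨ Disjoint U D := by
  induction Ds, h using Set.Finite.induction_on with
  | empty => exact ⟨{⊤}, by simp, by simp⟩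
  | @insert D Ds _ _ ih =>
    obtain ⟨P, hP, hdec⟩ := ih
    refine ⟨P.image (· ⊓ D) ∪ P.image (· ⊓ Dᶜ), ?_, ?_⟩
    · rw [Finset.sup_union, Finset.sup_image, Finset.sup_image]
      simp only [Function.id_comp]
      rw [← Finset.sup_inf_distrib_right P (fun x => x) D,
        ← Finset.sup_inf_distrib_right P (fun x => x) Dᶜ, ← inf_sup_left, sup_compl_eq_top,
        inf_top_eq]
      exact hP
    · intro U hU E hE
      simp only [Finset.mem_union, Finset.mem_image] at hU
      rcases hU with ⟨V, hV, rfl⟩ | ⟨V, hV, rfl⟩ <;> rcases hE with rfl | hE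
      · exact .inl inf_le_right
      · exact (hdec V hV E hE).imp inf_le_of_left_le fun h => h.mono_left inf_le_left
      · exact .inr (disjoint_compl_left.mono_left inf_le_right)
      · exact (hdec V hV E hE).imp inf_le_of_left_le fun h => h.mono_left inf_le_left

/-- The vanishing of an element of the algebra at a point is a local condition. -/
theorem exists_local_cover (hX : IsSubshift X) (hl : ∀ a : 𝒜, [a] ∈ language X)
    (y : SubshiftAlgebra R X) : ∃ P : Finset (boolAlg X), P.sup id = ⊤ ∧
      ∀ U ∈ P, ∀ q ∈ (U : Set X), pointRep R hX y (pointVector R X q) = 0 →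
        y * projection R X U = 0 := by
  obtain ⟨Ds, hfin, h⟩ := exists_deciders R hX hl y
  obtain ⟨P, hP, hdec⟩ := exists_deciding_cover hfin
  refine ⟨P, hP, fun U hU q hq h0 => ?_⟩
  obtain ⟨L, hL⟩ := exists_isGermMap R hX hl hq
  rw [h U (hdec U hU) q hq L hL, h0, map_zero]

theorem mem_coe_finset_sup {P : Finset (boolAlg X)} {q : X} :
    q ∈ ((P.sup id : boolAlg X) : Set X) ↔ ∃ U ∈ P, q ∈ (U : Set X) := by
  induction P using Finset.induction_on with
  | empty => simp
  | insert U P _ ih =>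
    rw [Finset.sup_insert]
    change q ∈ (U : Set X) ∨ q ∈ ((P.sup id : boolAlg X) : Set X) ↔ _
    rw [ih]
    simp

theorem exists_mem_of_sup_eq_top {P : Finset (boolAlg X)} (hP : P.sup id = ⊤) (q : X) :
    ∃ U ∈ P, q ∈ (U : Set X) := by
  rw [← mem_coe_finset_sup, hP]; trivial

theorem mul_projection_finset_sup_eq_zero {y : SubshiftAlgebra R X} {P : Finset (boolAlg X)}
    (h : ∀ U ∈ P, y * projection R X U = 0) : y * projection R X (P.sup id) = 0 := by
  induction P using Finset.induction_on with
  | empty => rw [Finset.sup_empty, projection_bot, mul_zero]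
  | insert U P _ ih =>
    have h1 := h U (Finset.mem_insert_self _ _)
    have h2 := ih fun V hV => h V (Finset.mem_insert_of_mem hV)
    rw [Finset.sup_insert, id_eq, projection_sup, projection_inf, mul_sub, mul_add, ← mul_assoc,
      h1, h2, zero_mul, add_zero, sub_zero]

/-- The point representation is faithful. -/
theorem eq_zero_of_pointRep (hX : IsSubshift X) (hl : ∀ a : 𝒜, [a] ∈ language X)
    {y : SubshiftAlgebra R X} (h : ∀ q : X, pointRep R hX y (pointVector R X q) = 0) : y = 0 := by
  obtain ⟨P, hP, hloc⟩ := exists_local_cover R hX hl y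
  have := mul_projection_finset_sup_eq_zero R (y := y) (P := P) fun U hU => by
    by_cases hne : ∃ q, q ∈ (U : Set X)
    · obtain ⟨q, hq⟩ := hne
      exact hloc U hU q hq (h q)
    -- An empty member offers no point to test, but its projection is zero.
    · have : U = ⊥ := coe_injective (Set.eq_empty_of_forall_notMem fun q hq => hne ⟨q, hq⟩)
      rw [this, projection_bot, mul_zero]
  rwa [hP, projection_top, mul_one] at this

/-- The member of the local cover through `p` contains the open point `e`, so vanishing at `p` alone
suffices. -/
theorem eq_zero_of_pointRep_isolated (hX : IsSubshift X) (hl : ∀ a : 𝒜, [a] ∈ language X)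
    {e : boolAlg X} {p : X} (he : (e : Set X) = {p}) {y : SubshiftAlgebra R X}
    (hy : y * projection R X e = y) (h : pointRep R hX y (pointVector R X p) = 0) : y = 0 := by
  obtain ⟨P, hP, hloc⟩ := exists_local_cover R hX hl y
  obtain ⟨U, hU, hpU⟩ := exists_mem_of_sup_eq_top hP p
  have heU : e ≤ U := by
    change (e : Set X) ⊆ U
    rwa [he, Set.singleton_subset_iff]
  rw [← hy, ← projection_mul_of_ge R heU, ← mul_assoc, hloc U hU p hpU h, zero_mul]

/-- The coefficients of the values of a monomial. -/
theorem pointRep_monomial_apply (hX : IsSubshift X) {α β : List 𝒜} {hα : α ∈ language X}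
    {hβ : β ∈ language X} {D : boolAlg X} (hD : D ≤ cyl hα hβ) (x q : X)
    (h : pointRep R hX (sWord R X α * tWord R X β * projection R X D) (pointVector R X x) q ≠ 0) :
    ∃ z, (x : ℕ → 𝒜) = concat β z ∧ (q : ℕ → 𝒜) = concat α z ∧
      pointRep R hX (sWord R X α * tWord R X β * projection R X D) (pointVector R X x) q =
        T (α.length - β.length) := by
  by_cases hx : x ∈ (D : Set X)
  · obtain ⟨z, hz, hαz⟩ := hD hx
    rw [pointRep_monomial R hX D hx hz, pointVector_coe R ⟨_, hαz⟩, Finsupp.smul_single,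
      smul_eq_mul, mul_one] at h ⊢
    have hq : (⟨_, hαz⟩ : X) = q := by
      by_contra hne
      exact h (Finsupp.single_eq_of_ne' hne)
    subst hq
    exact ⟨z, hz, rfl, Finsupp.single_eq_same⟩
  · rw [pointRep_monomial_of_notMem R hX D hx] at h
    exact (h rfl).elim

/-- A monomial only exchanges prefixes, hence relates only points with a common tail. -/
theorem pointRep_apply_eq_zero (hX : IsSubshift X) (hl : ∀ a : 𝒜, [a] ∈ language X) {x q : X}
    (h : ∀ i j, shift i (x : ℕ → 𝒜) ≠ shift j q) (y : SubshiftAlgebra R X) :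
    pointRep R hX y (pointVector R X x) q = 0 := by
  induction y using monomials_induction R hX hl with
  | mem m hm =>
    obtain ⟨α, hα, β, hβ, D, hD, rfl⟩ := hm
    by_contra hne
    obtain ⟨z, h1, h2, -⟩ := pointRep_monomial_apply R hX hD x q hne
    exact h β.length α.length (by rw [h1, h2, shift_concat, shift_concat])
  | zero => simp
  | add y z hy hz => rw [map_add, LinearMap.add_apply, Finsupp.add_apply, hy, hz, add_zero]
  | smul r y hy => rw [map_smul, LinearMap.smul_apply, Finsupp.smul_apply, hy, smul_zero]

/-- Two monomials of different degrees taking `x` to `q` would make two distinct shifts of `x`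
coincide. -/
theorem exists_pointRep_apply_eq (hX : IsSubshift X) (hl : ∀ a : 𝒜, [a] ∈ language X) {x q : X}
    (hx : Aperiodic (x : ℕ → 𝒜)) {i j : ℕ} (h : shift i (x : ℕ → 𝒜) = shift j q)
    (y : SubshiftAlgebra R X) :
    ∃ c : R, pointRep R hX y (pointVector R X x) q = c • (T (j - i) : R[T;T⁻¹]) := by
  induction y using monomials_induction R hX hl with
  | mem m hm =>
    obtain ⟨α, hα, β, hβ, D, hD, rfl⟩ := hm
    by_cases h0 : pointRep R hX (sWord R X α * tWord R X β * projection R X D)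
      (pointVector R X x) q = 0
    · exact ⟨0, by rw [h0, zero_smul]⟩
    · obtain ⟨z, h1, h2, h3⟩ := pointRep_monomial_apply R hX hD x q h0
      have e : shift β.length (x : ℕ → 𝒜) = shift α.length q := by
        rw [h1, h2, shift_concat, shift_concat]
      have e' : shift (α.length + i) (x : ℕ → 𝒜) = shift (j + β.length) x := by
        rw [← shift_shift, ← shift_shift, h, e, shift_shift, shift_shift, add_comm]
      have := hx e'
      refine ⟨1, ?_⟩
      rw [h3, one_smul]
      congr 1
      omega
  | zero => exact ⟨0, by simp⟩
  | add y z hy hz =>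
    obtain ⟨c, hc⟩ := hy
    obtain ⟨d, hd⟩ := hz
    exact ⟨c + d, by rw [map_add, LinearMap.add_apply, Finsupp.add_apply, hc, hd, add_smul]⟩
  | smul r y hy =>
    obtain ⟨c, hc⟩ := hy
    exact ⟨r * c, by rw [map_smul, LinearMap.smul_apply, Finsupp.smul_apply, hc, mul_smul]⟩

/-- A monomial is injective on points: `q = αz` determines `z`, hence the source `βz`. -/
theorem finite_pointRep_apply_ne_zero (hX : IsSubshift X) (hl : ∀ a : 𝒜, [a] ∈ language X)
    (q : X) (y : SubshiftAlgebra R X) :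
    {x : X | pointRep R hX y (pointVector R X x) q ≠ 0}.Finite := by
  induction y using monomials_induction R hX hl with
  | mem m hm =>
    obtain ⟨α, hα, β, hβ, D, hD, rfl⟩ := hm
    apply Set.Subsingleton.finite
    intro x hx x' hx'
    obtain ⟨z, h1, h2, -⟩ := pointRep_monomial_apply R hX hD x q hx
    obtain ⟨z', h1', h2', -⟩ := pointRep_monomial_apply R hX hD x' q hx'
    rw [h2] at h2'
    exact Subtype.ext (by rw [h1, h1', concat_right_injective α h2'])
  | zero => simp
  | add y z hy hz =>
    refine (hy.union hz).subset fun x hx => ?_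
    by_contra hne
    simp only [Set.mem_union, Set.mem_ofPred_eq, not_or, not_not] at hne hx
    exact hx (by rw [map_add, LinearMap.add_apply, Finsupp.add_apply, hne.1, hne.2, add_zero])
  | smul r y hy =>
    refine hy.subset fun x hx h0 => hx ?_
    rw [map_smul, LinearMap.smul_apply, Finsupp.smul_apply, h0, smul_zero]

theorem pEnd_apply (A : Set X) (f : PointModule R X) (x : X) :
    pEnd R A f x = if x ∈ A then f x else 0 := by
  induction f using Finsupp.induction_linear with
  | zero => simp
  | add f g hf hg => rw [map_add, Finsupp.add_apply, hf, hg]; split_ifs <;> simp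
  | single z c =>
    have : (Finsupp.single z c : PointModule R X) = c • pointVector R X z := by
      rw [pointVector_coe]; simp
    rw [this, map_smul, pEnd_pointVector]
    by_cases hxz : z = x
    · subst hxz; split_ifs <;> simp
    · split_ifs <;> simp [pointVector_coe, hxz]

theorem exists_separating (hX : IsSubshift X) (q : X) (F : Finset X) (hq : q ∉ F) :
    ∃ Z : boolAlg X, q ∈ (Z : Set X) ∧ ∀ x ∈ F, x ∉ (Z : Set X) := by
  induction F using Finset.induction_on with
  | empty => exact ⟨⊤, trivial, by simp⟩
  | insert x F _ ih =>
    rw [Finset.mem_insert, not_or] at hq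
    obtain ⟨Z, hZ, hF⟩ := ih hq.2
    obtain ⟨n, hn⟩ := Function.ne_iff.mp fun h => hq.1 (Subtype.ext h)
    have hL := word_mem_language q.2 (n + 1)
    refine ⟨Z ⊓ cyl (nil_mem_language hL) hL, ⟨hZ, shift (n + 1) q, ?_, ?_⟩, ?_⟩
    · rw [concat_word_shift]
    · rw [concat_nil]; exact hX.shift_mem q.2 _
    · intro y hy hyZ
      rcases Finset.mem_insert.mp hy with rfl | hy
      · obtain ⟨z, hz, -⟩ := hyZ.2
        apply hn
        rw [hz]
        simp [concat, word, -List.ofFn_succ]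
      · exact hF y hy hyZ.1

end Local
end UnitalSubshift

namespace UnitalSubshift

universe u v

/-! ### The irrational ideal is two-sided. -/

section IrrationalIdeal

variable (R : Type v) [CommRing R] {𝒜 : Type u} {X : Set (ℕ → 𝒜)}

variable (X) in
/-- The left ideal generated by the projections of the irrational paths. -/
noncomputable def irrationalIdeal : Ideal (SubshiftAlgebra R X) :=
  ⨆ A ∈ irrationalPaths X, Ideal.span {projection R X A}

theorem projection_mem_irrationalIdeal {A : boolAlg X} (hA : A ∈ irrationalPaths X) :
    projection R X A ∈ irrationalIdeal R X :=
  (le_iSup₂_of_le (f := fun A (_ : A ∈ irrationalPaths X) => Ideal.span {projection R X A})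
    A hA le_rfl) (Ideal.mem_span_singleton_self _)

theorem irrationalIdeal_mul_mem_of_projection {g : SubshiftAlgebra R X}
    (hg : ∀ A ∈ irrationalPaths X, projection R X A * g ∈ irrationalIdeal R X)
    {x : SubshiftAlgebra R X} (hx : x ∈ irrationalIdeal R X) : x * g ∈ irrationalIdeal R X := by
  have hle : irrationalIdeal R X ≤
      Submodule.comap (LinearMap.toSpanSingleton (SubshiftAlgebra R X) _ g)
        (irrationalIdeal R X) := by
    refine iSup₂_le fun A hA => ?_
    rw [Ideal.span_le, Set.singleton_subset_iff]
    exact hg A hA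
  exact hle hx

/-- Moving `p_{p}` to the right past a letter turns it into the projection of the shifted or
prolonged point, or into zero, and aperiodicity depends only on the tail. -/
theorem irrationalIdeal_mul_mem (hX : IsSubshift X) (hl : ∀ a : 𝒜, [a] ∈ language X)
    (y : SubshiftAlgebra R X) : ∀ x ∈ irrationalIdeal R X, x * y ∈ irrationalIdeal R X := by
  have key : ∀ (B : boolAlg X) (q : X), Aperiodic (q : ℕ → 𝒜) → (B : Set X) ⊆ {q} →
      projection R X B ∈ irrationalIdeal R X := by
    intro B q hq hB
    rcases Set.subset_singleton_iff_eq.mp hB with h | h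
    · rw [show B = ⊥ from coe_injective h, projection_bot]
      exact zero_mem _
    · exact projection_mem_irrationalIdeal R ((mem_irrationalPaths_iff hX).mpr ⟨q, h, hq⟩)
  induction y using subshiftAlgebra_induction with
  | scalar r =>
    intro x hx
    rw [← Algebra.commutes]
    exact Ideal.mul_mem_left _ _ hx
  | p B =>
    refine fun x => irrationalIdeal_mul_mem_of_projection R fun A hA => ?_
    rw [projection_mul_comm]
    exact Ideal.mul_mem_left _ _ (projection_mem_irrationalIdeal R hA)
  | s a =>
    refine fun x => irrationalIdeal_mul_mem_of_projection R fun A hA => ?_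
    obtain ⟨p, hA, hp⟩ := (mem_irrationalPaths_iff hX).mp hA
    obtain ⟨B, hB, h⟩ := exists_projection_mul_sLetter R hX hl a A
    rw [h]
    refine Ideal.mul_mem_left _ _ (key B ⟨_, hX.shift_mem p.2 1⟩
      (hp.of_shift_eq (i := 1) (j := 0) rfl) ?_)
    rw [hB, hA]
    rintro x ⟨y, rfl, hy⟩
    exact Subtype.ext (by simp [hy])
  | t a =>
    refine fun x => irrationalIdeal_mul_mem_of_projection R fun A hA => ?_
    obtain ⟨p, hA, hp⟩ := (mem_irrationalPaths_iff hX).mp hA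
    obtain ⟨B, hB, h⟩ := exists_projection_mul_tLetter R hX hl a A
    rw [h]
    refine Ideal.mul_mem_left _ _ ?_
    by_cases ha : concat [a] (p : ℕ → 𝒜) ∈ X
    · refine key B ⟨_, ha⟩ (hp.of_shift_eq (i := 0) (j := 1) (by simp)) ?_
      rw [hB, hA]
      rintro x ⟨y, rfl, hx⟩
      exact Subtype.ext hx
    · rw [show B = ⊥ from coe_injective ?_, projection_bot]
      · exact zero_mem _
      · rw [hB, hA]
        refine Set.eq_empty_of_forall_notMem ?_
        rintro x ⟨y, rfl, hx⟩
        exact ha (hx ▸ x.2)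
  | mul y z hy hz => intro w hw; rw [← mul_assoc]; exact hz _ (hy _ hw)
  | add y z hy hz => intro w hw; rw [mul_add]; exact add_mem (hy _ hw) (hz _ hw)

end IrrationalIdeal

theorem span_singleton_eq_of_isAtom {B : Type*} [Ring B] {I : Ideal B} (hI : IsAtom I) {z : B}
    (hz : z ∈ I) (h0 : z ≠ 0) : Ideal.span {z} = I :=
  (hI.le_iff.mp ((Ideal.span_singleton_le_iff_mem _).mpr hz)).resolve_left
    fun h => h0 (Ideal.span_singleton_eq_bot.mp h)

/-! ### Minimal left ideals. -/

section Socle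

open LaurentPolynomial

variable (R : Type v) [Field R] {𝒜 : Type u} {X : Set (ℕ → 𝒜)}

theorem pointRep_sWord_tWord_words (hX : IsSubshift X) {x q : X} {i j : ℕ}
    (h : shift i (x : ℕ → 𝒜) = shift j q) :
    pointRep R hX (sWord R X (word q 0 j) * tWord R X (word x 0 i)) (pointVector R X x) =
      (T (j - i) : R[T;T⁻¹]) • pointVector R X q := by
  have h1 : (x : ℕ → 𝒜) = concat (word x 0 i) (shift i x) := (concat_word_shift _ _).symm
  have h2 : (q : ℕ → 𝒜) = concat (word q 0 j) (shift i x) := by rw [h, concat_word_shift]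
  have := pointRep_sWord_tWord R hX (word q 0 j) (word x 0 i) (x := shift i x) (h1 ▸ x.2)
  rwa [← h1, ← h2, length_word, length_word] at this

theorem exists_projection_isolating (hX : IsSubshift X) (f : PointModule R X) (q : X) :
    ∃ Z : boolAlg X, pointRep R hX (projection R X Z) f = f q • pointVector R X q := by
  classical
  obtain ⟨Z, hq, hZ⟩ := exists_separating hX q (f.support.erase q) (Finset.notMem_erase q _)
  refine ⟨Z, ?_⟩
  ext1 x
  rw [pointRep_projection, pEnd_apply, pointVector_coe, Finsupp.smul_single, smul_eq_mul, mul_one]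
  by_cases hx : x = q
  · subst hx; rw [if_pos hq, Finsupp.single_eq_same]
  · rw [Finsupp.single_eq_of_ne hx]
    by_cases h0 : f x = 0
    · rw [h0, ite_self]
    · rw [if_neg (hZ x (Finset.mem_erase.mpr ⟨hx, Finsupp.mem_support_iff.mpr h0⟩))]

/-- The value of `x` at `p` has a nonzero coefficient `c T ^ (j - i)` at some `q`. Isolating `q` and
returning to `p` with degree `i - j` cancels the power of `T`, and elements supported on `e` are
determined by their value at `p`, so the product is `c p_e` with `c` invertible. -/
theorem mem_of_mul_projection_ne_zero (hX : IsSubshift X) (hl : ∀ a : 𝒜, [a] ∈ language X)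
    {e : boolAlg X} {p : X} (he : (e : Set X) = {p}) (hp : Aperiodic (p : ℕ → 𝒜))
    {I : Ideal (SubshiftAlgebra R X)} {x : SubshiftAlgebra R X} (hxI : x ∈ I)
    (hx : x * projection R X e = x) (hx0 : x ≠ 0) : projection R X e ∈ I := by
  have hv : pointRep R hX x (pointVector R X p) ≠ 0 := fun h =>
    hx0 (eq_zero_of_pointRep_isolated R hX hl he hx h)
  obtain ⟨q, hq⟩ := Finsupp.ne_iff.mp hv
  rw [Finsupp.zero_apply] at hq
  obtain ⟨i, j, hij⟩ : ∃ i j, shift i (p : ℕ → 𝒜) = shift j q := by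
    by_contra! h
    exact hq (pointRep_apply_eq_zero R hX hl h x)
  obtain ⟨c, hc⟩ := exists_pointRep_apply_eq R hX hl hp hij x
  have hc0 : c ≠ 0 := by rintro rfl; rw [hc, zero_smul] at hq; exact hq rfl
  obtain ⟨Z, hZ⟩ := exists_projection_isolating R hX (pointRep R hX x (pointVector R X p)) q
  set w := sWord R X (word p 0 i) * tWord R X (word q 0 j)
  have hz : pointRep R hX (w * projection R X Z * x) (pointVector R X p) =
      c • pointVector R X p := by
    rw [map_mul, map_mul, Module.End.mul_apply, Module.End.mul_apply, hZ, map_smul,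
      pointRep_sWord_tWord_words R hX hij.symm, hc, smul_smul, smul_mul_assoc, ← T_add,
      sub_add_sub_cancel, sub_self, T_zero, smul_assoc, one_smul]
  have hpe : pointRep R hX (projection R X e) (pointVector R X p) = pointVector R X p := by
    rw [pointRep_projection_pointVector, if_pos (by rw [he]; rfl)]
  have hdiff : w * projection R X Z * x - c • projection R X e = 0 := by
    apply eq_zero_of_pointRep_isolated R hX hl he
    · rw [sub_mul, mul_assoc, hx, smul_mul_assoc, projection_mul_of_le R le_rfl]
    · rw [map_sub, LinearMap.sub_apply, hz, map_smul, LinearMap.smul_apply, hpe, sub_self]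
  have : projection R X e = algebraMap R _ c⁻¹ * (w * projection R X Z * x) := by
    rw [sub_eq_zero.mp hdiff, ← Algebra.smul_def, smul_smul, inv_mul_cancel₀ hc0, one_smul]
  rw [this]
  exact I.mul_mem_left _ (I.mul_mem_left _ hxI)

theorem span_projection_le_leftSocle (hX : IsSubshift X) (hl : ∀ a : 𝒜, [a] ∈ language X)
    {e : boolAlg X} (he : e ∈ irrationalPaths X) :
    Ideal.span {projection R X e} ≤ leftSocle (SubshiftAlgebra R X) := by
  obtain ⟨p, hep, hp⟩ := (mem_irrationalPaths_iff hX).mp he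
  by_cases h0 : Ideal.span {projection R X e} = ⊥
  · rw [h0]; exact bot_le
  refine le_sSup ⟨h0, fun I hI => ?_⟩
  by_contra hne
  obtain ⟨x, hxI, hx0⟩ := Submodule.exists_mem_ne_zero_of_ne_bot hne
  obtain ⟨a, rfl⟩ := Ideal.mem_span_singleton'.mp (hI.le hxI)
  refine hI.not_ge ?_
  rw [Ideal.span_le, Set.singleton_subset_iff]
  exact mem_of_mul_projection_ne_zero R hX hl hep hp hxI
    (by rw [mul_assoc, projection_mul_of_le R le_rfl]) hx0

/-- If an element of a minimal left ideal sends a point to a nonzero multiple of a point `q`, then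
`q` is aperiodic. -/
theorem aperiodic_of_isAtom (hX : IsSubshift X) {I : Ideal (SubshiftAlgebra R X)} (hI : IsAtom I)
    {y : SubshiftAlgebra R X} (hy : y ∈ I) {p q : X} {f : R[T;T⁻¹]} (hf : f ≠ 0)
    (hyp : pointRep R hX y (pointVector R X p) = f • pointVector R X q) :
    Aperiodic (q : ℕ → 𝒜) := by
  have key : ∀ i j, i < j → shift i (q : ℕ → 𝒜) ≠ shift j q := by
    intro i j hij h
    -- `g` replaces the prefix of length `i` of `q` by the one of length `j`; it fixes `q` as a
    -- point but contributes `T ^ (j - i)`.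
    set g := sWord R X (word q 0 j) * tWord R X (word q 0 i)
    have hg : pointRep R hX (g * y - y) (pointVector R X p) =
        (f * (T (j - i) - 1)) • pointVector R X q := by
      rw [map_sub, map_mul, LinearMap.sub_apply, Module.End.mul_apply, hyp, map_smul,
        pointRep_sWord_tWord_words R hX h, smul_smul, mul_sub, mul_one, sub_smul]
    have hT : (T (j - i) - 1 : R[T;T⁻¹]) ≠ 0 := by
      intro h0
      have := congrArg (fun u : R[T;T⁻¹] => u.coeff 0) (sub_eq_zero.mp h0)
      rw [← T_zero] at this
      simp only [T_apply] at this
      rw [if_neg (by omega), if_pos trivial] at this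
      exact zero_ne_one this
    have hmem : g * y - y ∈ I := sub_mem (I.mul_mem_left _ hy) hy
    have hne : g * y - y ≠ 0 := by
      intro h0
      rw [h0, map_zero, LinearMap.zero_apply, pointVector_coe, Finsupp.smul_single, smul_eq_mul,
        mul_one, eq_comm, Finsupp.single_eq_zero] at hg
      exact mul_ne_zero hf hT hg
    have hspan := span_singleton_eq_of_isAtom hI hmem hne
    rw [← hspan] at hy
    obtain ⟨a, ha⟩ := Ideal.mem_span_singleton'.mp hy
    have h1 : f * (T (j - i) - 1) * pointRep R hX a (pointVector R X q) q = f := by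
      have := congrArg (fun v : PointModule R X => v q)
        (congrArg (fun z => pointRep R hX z (pointVector R X p)) ha)
      simp only [map_mul, Module.End.mul_apply, hg, hyp, map_smul] at this
      simpa [pointVector_coe] using this
    have h2 : (T (j - i) - 1) * pointRep R hX a (pointVector R X q) q = 1 := by
      rw [mul_assoc] at h1
      exact mul_left_cancel₀ hf (by rw [h1, mul_one])
    -- Setting `T = 1` kills `T ^ (j - i) - 1`, so it is not a unit.
    have h3 := congrArg (eval₂ (RingHom.id R) (1 : Rˣ)) h2
    rw [map_mul, map_sub, eval₂_T, map_one, one_zpow, Units.val_one, sub_self, zero_mul] at h3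
    exact zero_ne_one h3
  intro i j h
  rcases lt_trichotomy i j with hij | hij | hij
  · exact (key i j hij h).elim
  · exact hij
  · exact (key j i hij h.symm).elim

/-- A minimal left ideal is generated by any of its nonzero elements, so one nonzero member of the
irrational ideal inside `I` is enough. -/
theorem le_irrationalIdeal_of_isAtom (hX : IsSubshift X) (hl : ∀ a : 𝒜, [a] ∈ language X)
    {I : Ideal (SubshiftAlgebra R X)} (hI : IsAtom I) : I ≤ irrationalIdeal R X := by
  obtain ⟨x, hxI, hx0⟩ := Submodule.exists_mem_ne_zero_of_ne_bot hI.1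
  obtain ⟨p, hp⟩ : ∃ p : X, pointRep R hX x (pointVector R X p) ≠ 0 := by
    by_contra! h
    exact hx0 (eq_zero_of_pointRep R hX hl h)
  -- A nonzero `z` killing `p` would generate `I`, so `x` would kill `p` too.
  have hinj : ∀ z ∈ I, pointRep R hX z (pointVector R X p) = 0 → z = 0 := by
    intro z hz h
    by_contra hz0
    have hspan := span_singleton_eq_of_isAtom hI hz hz0
    rw [← hspan] at hxI
    obtain ⟨a, rfl⟩ := Ideal.mem_span_singleton'.mp hxI
    exact hp (by rw [map_mul, Module.End.mul_apply, h, map_zero])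
  obtain ⟨q, hq⟩ := Finsupp.ne_iff.mp hp
  rw [Finsupp.zero_apply] at hq
  obtain ⟨Z, hZ⟩ := exists_projection_isolating R hX (pointRep R hX x (pointVector R X p)) q
  set f := pointRep R hX x (pointVector R X p) q
  set y := projection R X Z * x
  have hyI : y ∈ I := I.mul_mem_left _ hxI
  have hyp : pointRep R hX y (pointVector R X p) = f • pointVector R X q := by
    rw [map_mul, Module.End.mul_apply, hZ]
  have hqap := aperiodic_of_isAtom R hX hI hyI hq hyp
  have hypq : pointRep R hX y (pointVector R X p) q ≠ 0 := by
    rw [hyp, pointVector_coe]; simpa using hq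
  have hfix : ∀ W : boolAlg X, q ∈ (W : Set X) → projection R X W * y = y := by
    intro W hW
    rw [← sub_eq_zero]
    apply hinj _ (sub_mem (I.mul_mem_left _ hyI) hyI)
    rw [map_sub, map_mul, LinearMap.sub_apply, Module.End.mul_apply, hyp, map_smul,
      pointRep_projection_pointVector, if_pos hW, sub_self]
  -- If the coefficient at `q` is zero, some `W` contains `q` and misses the whole support; as `p_W`
  -- fixes `y`, the value is zero.
  have hsupp : ∀ r : X, pointRep R hX y (pointVector R X r) q = 0 →
      pointRep R hX y (pointVector R X r) = 0 := by
    intro r hr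
    obtain ⟨W, hqW, hW⟩ := exists_separating hX q (pointRep R hX y (pointVector R X r)).support
      (by rwa [Finsupp.notMem_support_iff])
    ext1 z
    by_contra hz
    rw [← hfix W hqW, map_mul, Module.End.mul_apply, pointRep_projection, pEnd_apply] at hz
    by_cases hzW : z ∈ (W : Set X)
    · rw [if_pos hzW] at hz
      exact hW z (Finsupp.mem_support_iff.mpr hz) hzW
    · rw [if_neg hzW] at hz
      exact hz rfl
  obtain ⟨P, hP, hloc⟩ := exists_local_cover R hX hl y
  obtain ⟨U, hUP, hpU⟩ := exists_mem_of_sup_eq_top hP p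
  -- If the coefficient at `q` vanished for one `r ∈ U`, then `y p_U = 0`, against the nonzero value
  -- at `p`.
  have hUfin : (U : Set X).Finite := by
    refine (finite_pointRep_apply_ne_zero R hX hl q y).subset fun r hr h0 => ?_
    have h1 := hloc U hUP r hr (hsupp r h0)
    have h2 : pointRep R hX (y * projection R X U) (pointVector R X p) = 0 := by simp [h1]
    rw [map_mul, Module.End.mul_apply, pointRep_projection_pointVector, if_pos hpU] at h2
    rw [h2] at hypq
    exact hypq rfl
  have hpmem : ({p} : Set X) ∈ boolAlg X := by
    classical
    obtain ⟨W, hpW, hW⟩ := exists_separating hX p (hUfin.toFinset.erase p)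
      (Finset.notMem_erase p _)
    have hWU : ((W ⊓ U : boolAlg X) : Set X) = {p} := by
      refine Set.eq_singleton_iff_unique_mem.mpr ⟨mem_coe_inf.mpr ⟨hpW, hpU⟩, ?_⟩
      rintro z ⟨hzW, hzU⟩
      by_contra hne
      exact hW z (Finset.mem_erase.mpr ⟨hne, hUfin.mem_toFinset.mpr hzU⟩) hzW
    exact hWU ▸ (W ⊓ U : boolAlg X).2
  obtain ⟨i, j, hij⟩ : ∃ i j, shift i (p : ℕ → 𝒜) = shift j q := by
    by_contra! h
    exact hypq (pointRep_apply_eq_zero R hX hl h y)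
  -- `p` and `q` share a tail, and isolation passes up and down along shifts.
  have hqmem : ({q} : Set X) ∈ boolAlg X := by
    rw [singleton_mem_boolAlg_iff_shift hX hl j (y := (⟨_, hX.shift_mem p.2 i⟩ : X)) hij,
      ← singleton_mem_boolAlg_iff_shift hX hl i (x := p) rfl]
    exact hpmem
  have hyJ : y ∈ irrationalIdeal R X := by
    rw [← hfix ⟨_, hqmem⟩ rfl]
    exact irrationalIdeal_mul_mem R hX hl y _ (projection_mem_irrationalIdeal R
      ((mem_irrationalPaths_iff hX).mpr ⟨q, rfl, hqap⟩))
  have hy0 : y ≠ 0 := by rintro h; rw [h] at hypq; simp at hypq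
  have hspan := span_singleton_eq_of_isAtom hI hyI hy0
  rw [← hspan, Ideal.span_singleton_le_iff_mem]
  exact hyJ

end Socle
end UnitalSubshift

/-- The socle of the unital subshift algebra is the sum of the left ideals generated by the
projections of the irrational paths. Every letter of the alphabet is assumed to occur in `X`. -/
theorem mainTheorem1 {𝒜 : Type*} (R : Type*) [Field R] (X : Set (ℕ → 𝒜))
    (hX : UnitalSubshift.IsSubshift X)
    (hletters : ∀ a : 𝒜, [a] ∈ UnitalSubshift.language X) :
    UnitalSubshift.leftSocle (UnitalSubshift.SubshiftAlgebra R X) =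
      ⨆ A ∈ UnitalSubshift.irrationalPaths X,
        Ideal.span {UnitalSubshift.projection R X A} := by
  apply le_antisymm
  · exact sSup_le fun I hI => UnitalSubshift.le_irrationalIdeal_of_isAtom R hX hletters hI
  · exact iSup₂_le fun A hA => UnitalSubshift.span_projection_le_leftSocle R hX hletters hA
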